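/- **Proposition 2.8 (character homomorphism).** Let $p$ be a prime, let $S_0(\mathbf{Z}_p)$ be the monoid under composition of power series over $\mathbf{Z}_p$ without constant term, with the topology of coefficientwise convergence, and let $\mathfrak{m}_{\mathbf{C}_p}$ be the open unit disk of $\mathbf{C}_p$. Let $f,u\in S_0(\mathbf{Z}_p)$ satisfy: $f\circ u=u\circ f$; $u$ is invertible under composition and has infinite order; $v_p(f'(0))=1$ and $f$ has exactly $p$ roots in $\mathfrak{m}_{\mathbf{C}_p}$; and $v_p(1-u'(0)^m)=v_p(1-u'(0))+v_p(m)$ for all integers $m\ge 0$. Let $u^{\circ\mathbf{Z}_p}$ be the closed subgroup of the group of invertible elements of $S_0(\mathbf{Z}_p)$ topologically generated by $u$. Let $\Pi=(\pi_1,\pi_2,\dots)$ be a sequence in $\mathfrak{m}_{\mathbf{C}_p}$ with $\pi_1\ne 0$, $f(\pi_1)=0$ and $f(\pi_i)=\pi_{i-1}$ for $i>1$. Then there is a largest integer $k\ge 1$ with $u(\pi_k)=\pi_k$. Put $K=\mathbf{Q}_p(\pi_k)$ and $K_\infty=\mathbf{Q}_p(\pi_i\mid i>0)$, and let $G_K\supseteq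 G_{K_\infty}$ be their absolute Galois groups, viewed as subgroups of $G_{\mathbf{Q}_p}$, which acts continuously on $\mathbf{C}_p$. For every $\sigma\in G_K$ there is a unique $u_\sigma\in u^{\circ\mathbf{Z}_p}$ with $u_\sigma(\pi_i)=\sigma(\pi_i)$ for all $i>0$; put $\chi_f(\sigma)=u_\sigma'(0)$. An element of $u^{\circ\mathbf{Z}_p}$ is determined by its linear coefficient; write $[a]_f$ for the element with linear coefficient $a$, if there is one. The map $$[\chi_f]_f\colon G_K\to u^{\circ\mathbf{Z}_p},\qquad \sigma\mapsto[\chi_f(\sigma)]_f,$$ is a surjective group homomorphism with kernel $G_{K_\infty}$, and $[\chi_f(\sigma)]_f(\pi_i)=\sigma(\pi_i)$ for all $\sigma\in G_K$ and all $i>0$. -/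

import Mathlib

open scoped PowerSeries

noncomputable section

namespace Dyn

/-! ### The monoid of power series without constant term under composition -/

/-- `S0 R` is the set of formal power series over `R` without constant term. -/
@[ext]
structure S0 (R : Type*) [CommRing R] where
  /-- the underlying power series -/
  series : R⟦X⟧
  constantCoeff_eq_zero : PowerSeries.constantCoeff series = 0

namespace S0

variable {R : Type*} [CommRing R]

theorem hasSubst (g : S0 R) : PowerSeries.HasSubst g.series :=
  PowerSeries.HasSubst.of_constantCoeff_zero' g.constantCoeff_eq_zero

theorem coeff_pow_of_lt (h : S0 R) {n d : ℕ} (hd : n < d) :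
    PowerSeries.coeff n (h.series ^ d) = 0 := by
  have h1 : (PowerSeries.X : R⟦X⟧) ∣ h.series :=
    PowerSeries.X_dvd_iff.mpr h.constantCoeff_eq_zero
  exact PowerSeries.X_pow_dvd_iff.mp (pow_dvd_pow_of_dvd h1 d) n hd

theorem coeff_subst_eq_sum (g h : S0 R) (n : ℕ) :
    PowerSeries.coeff n (g.series.subst h.series) =
      ∑ d ∈ Finset.range (n + 1),
        PowerSeries.coeff d g.series * PowerSeries.coeff n (h.series ^ d) := by
  rw [PowerSeries.coeff_subst' h.hasSubst]
  rw [finsum_eq_sum_of_support_subset]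
  · rfl
  · intro d hd
    simp only [Finset.coe_range, Set.mem_Iio]
    by_contra hlt
    apply hd
    simp only [smul_eq_mul]
    rw [coeff_pow_of_lt h (by omega), mul_zero]

/-- The product of `g` and `h` is the composite `g ∘ h`, that is, the series `g(h(x))`;
the neutral element is the series `x`. -/
instance : Monoid (S0 R) where
  mul g h := ⟨g.series.subst h.series, by
    have := coeff_subst_eq_sum g h 0
    simpa [g.constantCoeff_eq_zero] using this⟩
  one := ⟨PowerSeries.X, by simp⟩
  mul_assoc a b c := by
    apply S0.ext
    exact PowerSeries.subst_comp_subst_apply b.hasSubst c.hasSubst a.series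
  one_mul a := by
    apply S0.ext
    exact PowerSeries.subst_X a.hasSubst
  mul_one a := by
    apply S0.ext
    exact PowerSeries.X_subst a.series

theorem series_mul (g h : S0 R) : (g * h).series = g.series.subst h.series := rfl

theorem series_one : (1 : S0 R).series = PowerSeries.X := rfl

/-- The linear coefficient `g'(0)` of `g`. -/
def deriv0 (g : S0 R) : R := PowerSeries.coeff 1 g.series

/-- The topology of coefficientwise convergence. -/
instance [TopologicalSpace R] : TopologicalSpace (S0 R) :=
  TopologicalSpace.induced (fun g (n : ℕ) => PowerSeries.coeff n g.series) inferInstance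

theorem continuous_coeff [TopologicalSpace R] (n : ℕ) :
    Continuous fun g : S0 R => PowerSeries.coeff n g.series :=
  (continuous_apply (A := fun _ : ℕ => R) n).comp
    (continuous_induced_dom (f := fun (g : S0 R) (m : ℕ) => PowerSeries.coeff m g.series))

theorem continuous_coeff_pow [TopologicalSpace R] [IsTopologicalRing R] (d : ℕ) :
    ∀ n : ℕ, Continuous fun g : S0 R => PowerSeries.coeff n (g.series ^ d) := by
  induction d with
  | zero =>
    intro n
    simpa using continuous_const
  | succ d ih =>
    intro n
    simp only [pow_succ, PowerSeries.coeff_mul]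
    exact continuous_finsetSum _ fun x _ => (ih x.1).mul (continuous_coeff x.2)

instance [TopologicalSpace R] [IsTopologicalRing R] : ContinuousMul (S0 R) where
  continuous_mul := by
    refine continuous_induced_rng.mpr (continuous_pi fun n => ?_)
    have h : ((fun (g : S0 R) (n : ℕ) => PowerSeries.coeff n g.series) ∘
        fun x : S0 R × S0 R => x.1 * x.2) = fun x n => ∑ d ∈ Finset.range (n + 1),
          PowerSeries.coeff d x.1.series * PowerSeries.coeff n (x.2.series ^ d) := by
      funext x n
      exact coeff_subst_eq_sum x.1 x.2 n
    rw [h]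
    exact continuous_finsetSum _ fun d _ =>
      ((continuous_coeff d).comp continuous_fst).mul
        ((continuous_coeff_pow d n).comp continuous_snd)

end S0

/-! ### The Galois action on `ℂ_[p]` and evaluation of power series -/

variable (p : ℕ) [Fact p.Prime]

/-- The absolute Galois group of `ℚ_[p]`. -/
abbrev GQp : Type := Gal(PadicAlgCl p/ℚ_[p])

/-- Galois automorphisms are isometries. Hence the Galois group acts on the completion `ℂ_[p]` of
`PadicAlgCl p`, by extending automorphisms continuously
(this is Mathlib's action on `UniformSpace.Completion`). -/
instance : UniformContinuousConstSMul (GQp p) (PadicAlgCl p) where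
  uniformContinuous_const_smul σ := by
    have h : Isometry fun x : PadicAlgCl p => σ • x := by
      refine Isometry.of_dist_eq fun x y => ?_
      rw [dist_eq_norm, dist_eq_norm, ← smul_sub]
      exact (spectralNorm_eq_of_equiv (K := ℚ_[p]) (L := PadicAlgCl p) σ (x - y)).symm
    exact h.uniformContinuous

variable {p}

/-- The value `g(x) = ∑ aₙ xⁿ` of a power series `g` over `ℤ_[p]` at a point `x` of `ℂ_[p]`; the
series converges for `‖x‖ < 1`, and only such points are used. -/
def eval (g : S0 ℤ_[p]) (x : ℂ_[p]) : ℂ_[p] :=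
  ∑' n : ℕ, ((PowerSeries.coeff n g.series : ℤ_[p]) : ℚ_[p]) • x ^ n

/-! ### Commuting pairs -/

/-- The standing assumptions on a pair `f`, `u` of power series over `ℤ_[p]`. The last one
says `v_p (1 - u'(0) ^ m) = v_p (1 - u'(0)) + v_p m`, including the case of infinite valuations. -/
structure IsCommutingPair (f : S0 ℤ_[p]) (u : (S0 ℤ_[p])ˣ) : Prop where
  comm : f * (u : S0 ℤ_[p]) = (u : S0 ℤ_[p]) * f
  infinite_order : ¬ IsOfFinOrder u
  valuation_deriv : f.deriv0.valuation = 1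
  card_roots : {x : ℂ_[p] | ‖x‖ < 1 ∧ eval f x = 0}.ncard = p
  norm_one_sub_pow : ∀ m : ℕ, ‖1 - (u : S0 ℤ_[p]).deriv0 ^ m‖ =
    ‖1 - (u : S0 ℤ_[p]).deriv0‖ * ‖(m : ℤ_[p])‖

/-- The closed subgroup `u^{∘ ℤ_p}` topologically generated by `u`. -/
def iterates (u : (S0 ℤ_[p])ˣ) : Subgroup (S0 ℤ_[p])ˣ :=
  (Subgroup.zpowers u).topologicalClosure

/-- `f`-consistent sequences `(s₁, s₂, s₃, …)` in the open unit disk of `ℂ_[p]`. -/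
structure IsConsistent (f : S0 ℤ_[p]) (s : ℕ+ → ℂ_[p]) : Prop where
  norm_lt_one : ∀ i, ‖s i‖ < 1
  eval_one : eval f (s 1) = 0
  eval_succ : ∀ i, eval f (s (i + 1)) = s i

/-- The field `K = ℚ_[p](π_k)`. -/
def fieldK (π : ℕ+ → ℂ_[p]) (k : ℕ+) : IntermediateField ℚ_[p] ℂ_[p] :=
  IntermediateField.adjoin ℚ_[p] {π k}

/-- The field `K_∞ = ℚ_[p](π_i | i > 0)`. -/
def fieldKInf (π : ℕ+ → ℂ_[p]) : IntermediateField ℚ_[p] ℂ_[p] :=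
  IntermediateField.adjoin ℚ_[p] (Set.range π)

/-- The absolute Galois group `G_L` of a subfield `L` of `ℂ_[p]` algebraic over `ℚ_[p]`, as the
subgroup of the absolute Galois group of `ℚ_[p]` fixing `L` pointwise. -/
def galoisGroup (L : IntermediateField ℚ_[p] ℂ_[p]) : Subgroup (GQp p) :=
  fixingSubgroup (GQp p) (L : Set ℂ_[p])

/-- The element `u_σ` of `u^{∘ ℤ_p}` with `u_σ(π_i) = σ(π_i)` for all `i`. -/
def galoisIterate (u : (S0 ℤ_[p])ˣ) (π : ℕ+ → ℂ_[p]) (σ : GQp p) : iterates u :=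
  Classical.epsilon fun e : iterates u =>
    ∀ i, eval ((e : (S0 ℤ_[p])ˣ) : S0 ℤ_[p]) (π i) = σ • π i

/-- The character `χ_f(σ) = u_σ'(0)`. -/
def chi (u : (S0 ℤ_[p])ˣ) (π : ℕ+ → ℂ_[p]) (σ : GQp p) : ℤ_[p] :=
  ((galoisIterate u π σ : (S0 ℤ_[p])ˣ) : S0 ℤ_[p]).deriv0

/-- The series `[a]_f`: the element of `u^{∘ ℤ_p}` with linear coefficient `a`. -/
def bracket (u : (S0 ℤ_[p])ˣ) (a : ℤ_[p]) : iterates u :=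
  Classical.epsilon fun e : iterates u => ((e : (S0 ℤ_[p])ˣ) : S0 ℤ_[p]).deriv0 = a

end Dyn

end

noncomputable section

namespace Dyn

/-! The root count forces `f` to have order `p` modulo `p`. As `f'(0)` is a uniformizer, Weierstrass
preparation makes each quotient `f^{∘(n+1)} / f^{∘n} = (f/x) ∘ f^{∘n}` an Eisenstein polynomial of
degree `(p-1)p^n` times a unit. So its zeros (`level`) form one Galois orbit of that size, and a
series over `ℤ_[p]` vanishing at one of them is divisible by the quotient
(`IsHeightOne.exists_irreducible`).

The arithmetic core is an exact valuation. Let `g ≠ 1` commute with `f`, let `π_k` be the last point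
of the tower `0, π₁, π₂, …` fixed by `g`, and let `p^m` be the exact power of `p` dividing `g - x`.
Then `g - x = p^m f^{∘k} w` with `w` a unit, whence `v(g'(0) - 1) = m + k`
(`norm_deriv0_sub_one_eq`). If `g^t` fixes `π_n`, the same divisibility gives `v(g'(0)^t - 1) ≥ m +
n`. For `g = u`, the valuation hypothesis turns this into `v(t) ≥ n - k` (`pow_dvd_of_fixed`). Hence
for `n ≥ k` the first `p^{n-k}` powers of `u` send `π_n` to distinct points of the fibre of
`f^{∘(n-k)}` over `π_k`. That fibre has only `p^{n-k}` points, so the powers of `u` are transitive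
on it (`exists_pow_eval_eq`).

An element of `G_K` preserves these fibres, so on each `π_n` it acts as a power of `u`; compactness
of `u^{∘ℤ_p}` yields one element for all `n`. Conversely, elements of `u^{∘ℤ_p}` permute each level,
on which Galois is transitive, and compactness of the Galois group gives surjectivity. A nonzero
series has finitely many zeros in the disk, so values on the tower determine a series. The group is
commutative because a series commuting with `f` is determined by its linear coefficient. -/

variable {p : ℕ} [Fact p.Prime]

/-! ### Evaluation of power series on the open unit disk -/

/-- The inclusion of `ℤ_[p]` into `ℂ_[p]`. -/
def intHom (p : ℕ) [Fact p.Prime] : ℤ_[p] →+* ℂ_[p] :=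
  (algebraMap ℚ_[p] ℂ_[p]).comp PadicInt.Coe.ringHom

theorem intHom_apply (a : ℤ_[p]) : intHom p a = algebraMap ℚ_[p] ℂ_[p] (a : ℚ_[p]) := rfl

theorem intHom_mul_eq_smul (a : ℤ_[p]) (x : ℂ_[p]) : intHom p a * x = (a : ℚ_[p]) • x := by
  rw [Algebra.smul_def]; rfl

theorem norm_intHom (a : ℤ_[p]) : ‖intHom p a‖ = ‖a‖ := by
  rw [intHom_apply, norm_algebraMap']; rfl

theorem intHom_injective : Function.Injective (intHom p) := by
  intro a b h
  rw [← sub_eq_zero, ← norm_eq_zero, ← norm_intHom, map_sub, h, sub_self, norm_zero]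

theorem norm_intHom_le_one (a : ℤ_[p]) : ‖intHom p a‖ ≤ 1 := by
  rw [norm_intHom]; exact a.norm_le_one

theorem norm_term_le (G : ℤ_[p]⟦X⟧) (x : ℂ_[p]) (n : ℕ) :
    ‖intHom p (PowerSeries.coeff n G) * x ^ n‖ ≤ ‖x‖ ^ n := by
  rw [norm_mul, norm_pow]
  exact mul_le_of_le_one_left (by positivity) (norm_intHom_le_one _)

theorem summable_norm_term (G : ℤ_[p]⟦X⟧) {x : ℂ_[p]} (hx : ‖x‖ < 1) :
    Summable fun n => ‖intHom p (PowerSeries.coeff n G) * x ^ n‖ :=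
  Summable.of_nonneg_of_le (fun _ => norm_nonneg _) (norm_term_le G x)
    (summable_geometric_of_lt_one (norm_nonneg x) hx)

theorem summable_term (G : ℤ_[p]⟦X⟧) {x : ℂ_[p]} (hx : ‖x‖ < 1) :
    Summable fun n => intHom p (PowerSeries.coeff n G) * x ^ n :=
  (summable_norm_term G hx).of_norm

/-- Evaluation of power series over `ℤ_[p]` at a point of the open unit disk. -/
def evalHom (x : ℂ_[p]) (hx : ‖x‖ < 1) : ℤ_[p]⟦X⟧ →+* ℂ_[p] where
  toFun G := ∑' n : ℕ, intHom p (PowerSeries.coeff n G) * x ^ n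
  map_one' := by
    rw [tsum_eq_single 0]
    · simp
    · intro n hn
      simp [PowerSeries.coeff_one, hn]
  map_zero' := by simp
  map_add' G H := by
    rw [← (summable_term G hx).tsum_add (summable_term H hx)]
    simp [add_mul]
  map_mul' G H := by
    rw [tsum_mul_tsum_eq_tsum_sum_antidiagonal_of_summable_norm (summable_norm_term G hx)
      (summable_norm_term H hx)]
    refine tsum_congr fun n => ?_
    rw [PowerSeries.coeff_mul, map_sum, Finset.sum_mul]
    refine Finset.sum_congr rfl fun ij hij => ?_
    rw [← Finset.HasAntidiagonal.mem_antidiagonal.mp hij, map_mul, pow_add]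
    ring

theorem evalHom_apply {x : ℂ_[p]} (hx : ‖x‖ < 1) (G : ℤ_[p]⟦X⟧) :
    evalHom x hx G = ∑' n : ℕ, intHom p (PowerSeries.coeff n G) * x ^ n := rfl

theorem eval_eq_evalHom (g : S0 ℤ_[p]) {x : ℂ_[p]} (hx : ‖x‖ < 1) :
    eval g x = evalHom x hx g.series := by
  simp only [eval, evalHom_apply, intHom_mul_eq_smul]

theorem evalHom_C {x : ℂ_[p]} (hx : ‖x‖ < 1) (a : ℤ_[p]) :
    evalHom x hx (PowerSeries.C a) = intHom p a := by
  rw [evalHom_apply, tsum_eq_single 0]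
  · simp
  · intro n hn
    simp [PowerSeries.coeff_C, hn]

theorem evalHom_X {x : ℂ_[p]} (hx : ‖x‖ < 1) :
    evalHom x hx PowerSeries.X = x := by
  rw [evalHom_apply, tsum_eq_single 1]
  · simp
  · intro n hn
    simp [PowerSeries.coeff_X, hn]

theorem evalHom_coe {x : ℂ_[p]} (hx : ‖x‖ < 1) (P : Polynomial ℤ_[p]) :
    evalHom x hx (P : ℤ_[p]⟦X⟧) = P.eval₂ (intHom p) x := by
  induction P using Polynomial.induction_on' with
  | add P Q hP hQ => rw [Polynomial.coe_add, map_add, hP, hQ, Polynomial.eval₂_add]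
  | monomial n a =>
    rw [← Polynomial.C_mul_X_pow_eq_monomial, Polynomial.coe_mul, Polynomial.coe_C,
      Polynomial.coe_pow, Polynomial.coe_X, map_mul, map_pow, evalHom_C, evalHom_X]
    simp

theorem norm_evalHom_le_one {x : ℂ_[p]} (hx : ‖x‖ < 1) (G : ℤ_[p]⟦X⟧) :
    ‖evalHom x hx G‖ ≤ 1 := by
  rw [evalHom_apply]
  refine IsUltrametricDist.norm_tsum_le_of_forall_le_of_nonneg zero_le_one fun n => ?_
  exact (norm_term_le G x n).trans (pow_le_one₀ (norm_nonneg _) hx.le)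

theorem evalHom_ne_zero_of_isUnit {x : ℂ_[p]} (hx : ‖x‖ < 1) {G : ℤ_[p]⟦X⟧} (hG : IsUnit G) :
    evalHom x hx G ≠ 0 := (hG.map (evalHom x hx)).ne_zero

theorem S0.X_dvd (g : S0 ℤ_[p]) : (PowerSeries.X : ℤ_[p]⟦X⟧) ∣ g.series :=
  PowerSeries.X_dvd_iff.mpr g.constantCoeff_eq_zero

theorem norm_eval_le (g : S0 ℤ_[p]) {x : ℂ_[p]} (hx : ‖x‖ < 1) : ‖eval g x‖ ≤ ‖x‖ := by
  obtain ⟨h, hh⟩ := g.X_dvd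
  rw [eval_eq_evalHom g hx, hh, map_mul, evalHom_X, norm_mul]
  exact mul_le_of_le_one_right (norm_nonneg _) (norm_evalHom_le_one hx h)

theorem norm_eval_lt_one (g : S0 ℤ_[p]) {x : ℂ_[p]} (hx : ‖x‖ < 1) : ‖eval g x‖ < 1 :=
  (norm_eval_le g hx).trans_lt hx

theorem evalHom_subst (G : ℤ_[p]⟦X⟧) (h : S0 ℤ_[p]) {x : ℂ_[p]} (hx : ‖x‖ < 1) :
    evalHom x hx (G.subst h.series) = evalHom (eval h x) (norm_eval_lt_one h hx) G := by
  set F : ℕ → ℕ → ℂ_[p] := fun d n =>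
    intHom p (PowerSeries.coeff d G) * (intHom p (PowerSeries.coeff n (h.series ^ d)) * x ^ n)
    with hF
  have hzero : ∀ d n, n < d → F d n = 0 := fun d n hdn => by
    simp [hF, S0.coeff_pow_of_lt h hdn]
  -- Only terms with `d ≤ n` survive, and for these `‖x‖^n = r^n r^n ≤ r^d r^n`. The double series
  -- is thus dominated by a product of two geometric series, and its sums may be exchanged.
  set r := Real.sqrt ‖x‖ with hr
  have hr0 : 0 ≤ r := Real.sqrt_nonneg _
  have hr1 : r < 1 := by
    rw [hr, Real.sqrt_lt' one_pos]; simpa using hx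
  have hrr : r * r = ‖x‖ := Real.mul_self_sqrt (norm_nonneg x)
  have hbound : ∀ q : ℕ × ℕ, ‖Function.uncurry F q‖ ≤ r ^ q.1 * r ^ q.2 := by
    rintro ⟨d, n⟩
    simp only [Function.uncurry]
    by_cases hdn : n < d
    · rw [hzero d n hdn, norm_zero]; positivity
    · calc ‖F d n‖ ≤ 1 * ‖x‖ ^ n := by
            rw [hF]; dsimp only
            rw [norm_mul]
            exact mul_le_mul (norm_intHom_le_one _) (norm_term_le _ x n) (norm_nonneg _) zero_le_one
        _ = r ^ n * r ^ n := by rw [one_mul, ← hrr, mul_pow]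
        _ ≤ r ^ d * r ^ n := mul_le_mul_of_nonneg_right
            (pow_le_pow_of_le_one hr0 hr1.le (not_lt.mp hdn)) (by positivity)
  have hsum : Summable (Function.uncurry F) := by
    refine Summable.of_norm_bounded ?_ hbound
    exact (summable_geometric_of_lt_one hr0 hr1).mul_of_nonneg
      (summable_geometric_of_lt_one hr0 hr1) (fun _ => by positivity) (fun _ => by positivity)
  have h1 : evalHom x hx (G.subst h.series) = ∑' n, ∑' d, F d n := by
    rw [evalHom_apply]
    refine tsum_congr fun n => ?_
    have hc : PowerSeries.coeff n (G.subst h.series) = ∑ d ∈ Finset.range (n + 1),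
        PowerSeries.coeff d G * PowerSeries.coeff n (h.series ^ d) := by
      rw [PowerSeries.coeff_subst' h.hasSubst, finsum_eq_sum_of_support_subset]
      · rfl
      · intro d hd
        simp only [Finset.coe_range, Set.mem_Iio]
        by_contra hlt
        exact hd (by simp [S0.coeff_pow_of_lt h (show n < d by omega)])
    rw [hc, map_sum, Finset.sum_mul, tsum_eq_sum (s := Finset.range (n + 1))]
    · refine Finset.sum_congr rfl fun d _ => ?_
      rw [hF, map_mul, mul_assoc]
    · intro d hd
      exact hzero d n (by simpa using hd)
  rw [h1, hsum.tsum_comm, evalHom_apply]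
  refine tsum_congr fun d => ?_
  rw [hF]; dsimp only
  rw [tsum_mul_left, eval_eq_evalHom h hx, ← map_pow, evalHom_apply]

theorem eval_mul (g h : S0 ℤ_[p]) {x : ℂ_[p]} (hx : ‖x‖ < 1) :
    eval (g * h) x = eval g (eval h x) := by
  rw [eval_eq_evalHom _ hx, S0.series_mul, evalHom_subst, eval_eq_evalHom g (norm_eval_lt_one h hx)]

theorem eval_one {x : ℂ_[p]} (hx : ‖x‖ < 1) : eval (1 : S0 ℤ_[p]) x = x := by
  rw [eval_eq_evalHom _ hx, S0.series_one, evalHom_X]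

theorem eval_zero (g : S0 ℤ_[p]) : eval g 0 = 0 := by
  have h := norm_eval_le g (x := 0) (by simp)
  rwa [norm_zero, norm_le_zero_iff] at h

theorem continuous_eval {x : ℂ_[p]} (hx : ‖x‖ < 1) :
    Continuous fun g : S0 ℤ_[p] => eval g x := by
  have h : (fun g : S0 ℤ_[p] => eval g x) =
      fun g => ∑' n : ℕ, intHom p (PowerSeries.coeff n g.series) * x ^ n := by
    funext g; rw [eval_eq_evalHom g hx, evalHom_apply]
  rw [h]
  refine continuous_tsum (fun n => ?_) (summable_geometric_of_lt_one (norm_nonneg x) hx)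
    fun n g => norm_term_le g.series x n
  have hc : Continuous (intHom p) :=
    (AddMonoidHomClass.isometry_of_norm (intHom p) norm_intHom).continuous
  exact (hc.comp (S0.continuous_coeff n)).mul continuous_const

/-! ### Reduction modulo `p`, Weierstrass preparation and Eisenstein series -/

open IsLocalRing

/-- Reduction of power series modulo `p`. -/
def red : ℤ_[p]⟦X⟧ →+* (ResidueField ℤ_[p])⟦X⟧ := PowerSeries.map (residue ℤ_[p])

theorem coeff_red (G : ℤ_[p]⟦X⟧) (n : ℕ) :
    PowerSeries.coeff n (red G) = residue ℤ_[p] (PowerSeries.coeff n G) :=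
  PowerSeries.coeff_map _ _ _

/-- Over a field, `a` is a power of `x` times a unit, and substitution preserves units, so only the
power of `b` contributes to the order. -/
theorem order_subst_of_field {k : Type*} [Field k] (a b : k⟦X⟧)
    (hb : PowerSeries.constantCoeff b = 0) (ha : a ≠ 0) :
    PowerSeries.order (a.subst b : k⟦X⟧) = a.order * b.order := by
  have hs : PowerSeries.HasSubst b := PowerSeries.HasSubst.of_constantCoeff_zero' hb
  set φ : k⟦X⟧ →ₐ[k] k⟦X⟧ := PowerSeries.substAlgHom (R := k) (S := k) hs with hφ
  have h1 : a = PowerSeries.X ^ a.order.toNat * PowerSeries.divXPowOrder a :=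
    PowerSeries.X_pow_order_mul_divXPowOrder.symm
  have hu : IsUnit (PowerSeries.divXPowOrder a) := by
    rw [PowerSeries.isUnit_iff_constantCoeff, isUnit_iff_ne_zero]
    exact fun h => ha (PowerSeries.constantCoeff_divXPowOrder_eq_zero_iff.mp h)
  have h2 : (a.subst b : k⟦X⟧) = b ^ a.order.toNat * φ (PowerSeries.divXPowOrder a) := by
    rw [← PowerSeries.coe_substAlgHom hs, ← hφ]
    conv_lhs => rw [h1]
    rw [map_mul, map_pow, hφ, PowerSeries.substAlgHom_X]
  have h3 : PowerSeries.order (φ (PowerSeries.divXPowOrder a)) = 0 :=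
    PowerSeries.order_zero_of_unit (hu.map φ)
  rw [h2, PowerSeries.order_mul, PowerSeries.order_pow, h3, add_zero, nsmul_eq_mul,
    PowerSeries.coe_toNat_order ha]

theorem red_subst (G : ℤ_[p]⟦X⟧) (h : S0 ℤ_[p]) :
    red (G.subst h.series) = (red G).subst (red h.series) :=
  PowerSeries.map_subst (h := residue ℤ_[p]) h.hasSubst G

theorem order_red_subst (G : ℤ_[p]⟦X⟧) (h : S0 ℤ_[p]) (hG : red G ≠ 0) :
    (red (G.subst h.series : ℤ_[p]⟦X⟧)).order = (red G).order * (red h.series).order := by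
  rw [red_subst]
  refine order_subst_of_field _ _ ?_ hG
  rw [← PowerSeries.coeff_zero_eq_constantCoeff_apply, coeff_red,
    PowerSeries.coeff_zero_eq_constantCoeff_apply, h.constantCoeff_eq_zero, map_zero]

theorem red_eq_zero_iff (G : ℤ_[p]⟦X⟧) : red G = 0 ↔ PowerSeries.C (p : ℤ_[p]) ∣ G := by
  constructor
  · intro h
    have h1 : ∀ n, (p : ℤ_[p]) ∣ PowerSeries.coeff n G := fun n => by
      have h2 : PowerSeries.coeff n (red G) = 0 := by rw [h, map_zero]
      rw [coeff_red, residue_eq_zero_iff, PadicInt.maximalIdeal_eq_span_p,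
        Ideal.mem_span_singleton] at h2
      exact h2
    choose c hc using h1
    refine ⟨PowerSeries.mk c, ?_⟩
    ext n
    rw [PowerSeries.coeff_C_mul, PowerSeries.coeff_mk, hc]
  · rintro ⟨H, rfl⟩
    ext n
    rw [coeff_red, PowerSeries.coeff_C_mul, map_mul, map_zero, mul_eq_zero]
    left
    rw [residue_eq_zero_iff, PadicInt.maximalIdeal_eq_span_p]
    exact Ideal.mem_span_singleton_self _

theorem exists_weierstrass {G : ℤ_[p]⟦X⟧} (hG : red G ≠ 0) :
    ∃ (P : Polynomial ℤ_[p]) (U : ℤ_[p]⟦X⟧), P.IsDistinguishedAt (maximalIdeal ℤ_[p]) ∧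
      IsUnit U ∧ G = P * U ∧ (P.natDegree : ℕ∞) = (red G).order := by
  obtain ⟨P, U, h⟩ := PowerSeries.exists_isWeierstrassFactorization (g := G) hG
  refine ⟨P, U, h.isDistinguishedAt, h.isUnit, h.eq_mul, ?_⟩
  rw [h.natDegree_eq_toNat_order_map]
  exact PowerSeries.coe_toNat_order hG

/-- For `‖z‖ ≥ 1` the leading term strictly dominates all others, whose coefficients lie in the
maximal ideal; the ultrametric inequality then forbids cancellation. -/
theorem norm_lt_one_of_isDistinguishedAt {P : Polynomial ℤ_[p]}
    (hP : P.IsDistinguishedAt (maximalIdeal ℤ_[p])) {z : ℂ_[p]} (hz : P.eval₂ (intHom p) z = 0) :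
    ‖z‖ < 1 := by
  by_contra hlt
  have h1 : 1 ≤ ‖z‖ := not_lt.mp hlt
  rw [Polynomial.eval₂_eq_sum_range, Finset.sum_range_succ, hP.monic.coeff_natDegree, map_one,
    one_mul] at hz
  have h2 : ‖∑ i ∈ Finset.range P.natDegree, intHom p (P.coeff i) * z ^ i‖ < ‖z‖ ^ P.natDegree := by
    by_cases hd : P.natDegree = 0
    · simp [hd]
    obtain ⟨i, hi, hle⟩ := IsUltrametricDist.exists_norm_finsetSum_le_of_nonempty
      (Finset.nonempty_range_iff.mpr hd) (fun i => intHom p (P.coeff i) * z ^ i)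
    refine hle.trans_lt ?_
    rw [Finset.mem_range] at hi
    have h3 : ‖intHom p (P.coeff i)‖ < 1 := by
      rw [norm_intHom]
      exact PadicInt.mem_nonunits.mp (hP.mem hi)
    rw [norm_mul, norm_pow]
    calc ‖intHom p (P.coeff i)‖ * ‖z‖ ^ i < 1 * ‖z‖ ^ i :=
          mul_lt_mul_of_pos_right h3 (by positivity)
      _ ≤ ‖z‖ ^ P.natDegree := by
          rw [one_mul]; exact pow_le_pow_right₀ h1 hi.le
  rw [eq_neg_of_add_eq_zero_left hz, norm_neg, norm_pow] at h2
  exact lt_irrefl _ h2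

theorem exists_eq_C_pow_mul {G : ℤ_[p]⟦X⟧} (hG : G ≠ 0) :
    ∃ (m : ℕ) (H : ℤ_[p]⟦X⟧), red H ≠ 0 ∧ G = PowerSeries.C (p : ℤ_[p]) ^ m * H := by
  have hp : ¬ IsUnit (PowerSeries.C (p : ℤ_[p])) := by
    rw [PowerSeries.isUnit_iff_constantCoeff, PowerSeries.constantCoeff_C]
    exact PadicInt.prime_p.not_isUnit
  obtain ⟨H, hH, hd⟩ := (FiniteMultiplicity.of_not_isUnit hp hG).exists_eq_pow_mul_and_not_dvd
  exact ⟨_, H, fun h => hd ((red_eq_zero_iff H).mp h), hH⟩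

theorem evalHom_C_p_ne_zero {z : ℂ_[p]} (hz : ‖z‖ < 1) :
    evalHom z hz (PowerSeries.C (p : ℤ_[p])) ≠ 0 := by
  rw [evalHom_C, map_ne_zero_iff _ intHom_injective]
  exact PadicInt.prime_p.ne_zero

-- Once a power of `p` is removed, Weierstrass preparation leaves a polynomial times a unit, and
-- only the polynomial can vanish.
open Classical in
theorem finite_zeros {G : ℤ_[p]⟦X⟧} (hG : G ≠ 0) :
    {z : ℂ_[p] | ∃ hz : ‖z‖ < 1, evalHom z hz G = 0}.Finite := by
  obtain ⟨m, H, hH, rfl⟩ := exists_eq_C_pow_mul hG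
  obtain ⟨P, U, hP, hU, rfl, -⟩ := exists_weierstrass hH
  refine ((P.map (intHom p)).roots.toFinset.finite_toSet).subset ?_
  rintro z ⟨hz, h0⟩
  rw [map_mul, map_mul, map_pow, mul_eq_zero, mul_eq_zero] at h0
  have h1 : P.eval₂ (intHom p) z = 0 := by
    rcases h0 with h0 | h0 | h0
    · exact absurd h0 (pow_ne_zero _ (evalHom_C_p_ne_zero hz))
    · rwa [evalHom_coe] at h0
    · exact absurd h0 (evalHom_ne_zero_of_isUnit hz hU)
  simp only [Finset.mem_coe, Multiset.mem_toFinset]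
  rw [Polynomial.mem_roots (hP.monic.map _).ne_zero, Polynomial.IsRoot, Polynomial.eval_map]
  exact h1

theorem exists_zero {G : ℤ_[p]⟦X⟧} (hG : red G ≠ 0) (hu : ¬ IsUnit G) :
    ∃ (z : ℂ_[p]) (hz : ‖z‖ < 1), evalHom z hz G = 0 := by
  obtain ⟨P, U, hP, hU, rfl, -⟩ := exists_weierstrass hG
  have hd : P.natDegree ≠ 0 := by
    intro h0
    rw [hP.monic.natDegree_eq_zero.mp h0, Polynomial.coe_one, one_mul] at hu
    exact hu hU
  obtain ⟨z, hz⟩ := IsAlgClosed.exists_root (P.map (intHom p)) (by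
    rw [hP.monic.degree_map, Polynomial.degree_eq_natDegree hP.monic.ne_zero]
    exact_mod_cast hd)
  rw [Polynomial.IsRoot, Polynomial.eval_map] at hz
  have hz1 := norm_lt_one_of_isDistinguishedAt hP hz
  exact ⟨z, hz1, by rw [map_mul, evalHom_coe, hz, zero_mul]⟩

theorem aeval_map_eq (P : Polynomial ℤ_[p]) (z : ℂ_[p]) :
    Polynomial.aeval z (P.map (algebraMap ℤ_[p] ℚ_[p])) = P.eval₂ (intHom p) z := by
  rw [Polynomial.aeval_def, Polynomial.eval₂_map]; rfl

/-- A power series over `ℤ_[p]` of Eisenstein type has the zeros of an irreducible polynomial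
over `ℚ_[p]`, and generates the ideal of series vanishing at any of these. -/
theorem exists_irreducible_of_eisenstein {G : ℤ_[p]⟦X⟧} {d : ℕ} (hd : 0 < d)
    (hG : (red G).order = d) (h0 : PowerSeries.constantCoeff G ∉ maximalIdeal ℤ_[p] ^ 2) :
    ∃ Q : Polynomial ℚ_[p], Irreducible Q ∧ Q.Monic ∧ Q.natDegree = d ∧
      (∀ z : ℂ_[p], Polynomial.aeval z Q = 0 → ‖z‖ < 1) ∧
      (∀ (z : ℂ_[p]) (hz : ‖z‖ < 1), evalHom z hz G = 0 ↔ Polynomial.aeval z Q = 0) ∧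
      ∀ (z : ℂ_[p]) (hz : ‖z‖ < 1), evalHom z hz G = 0 → ∀ H, evalHom z hz H = 0 → G ∣ H := by
  have hG0 : red G ≠ 0 := by
    intro h; rw [h, PowerSeries.order_zero] at hG; exact ENat.top_ne_natCast d hG
  obtain ⟨P, U, hP, hU, hGP, hdeg⟩ := exists_weierstrass hG0
  rw [hG, Nat.cast_inj] at hdeg
  have hP0 : P.coeff 0 ∉ maximalIdeal ℤ_[p] ^ 2 := by
    intro h
    apply h0
    rw [hGP, map_mul, ← PowerSeries.coeff_zero_eq_constantCoeff_apply, Polynomial.coeff_coe]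
    exact Ideal.mul_mem_right _ _ h
  have hE : P.IsEisensteinAt (maximalIdeal ℤ_[p]) :=
    { leading := by
        rw [hP.monic.leadingCoeff]
        exact fun h => (Ideal.ne_top_iff_one _).mp (maximalIdeal.isMaximal _).ne_top h
      mem := hP.mem
      notMem := hP0 }
  have hirr : Irreducible (P.map (algebraMap ℤ_[p] ℚ_[p])) :=
    (hP.monic.irreducible_iff_irreducible_map_fraction_map).mp
      (hE.irreducible (maximalIdeal.isMaximal _).isPrime hP.monic.isPrimitive (by omega))
  have hiff : ∀ (z : ℂ_[p]) (hz : ‖z‖ < 1), evalHom z hz G = 0 ↔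
      Polynomial.aeval z (P.map (algebraMap ℤ_[p] ℚ_[p])) = 0 := by
    intro z hz
    rw [aeval_map_eq, hGP, map_mul, evalHom_coe, mul_eq_zero,
      or_iff_left (evalHom_ne_zero_of_isUnit hz hU)]
  refine ⟨P.map (algebraMap ℤ_[p] ℚ_[p]), hirr, hP.monic.map _, ?_, ?_, hiff, ?_⟩
  · rw [hP.monic.natDegree_map, hdeg]
  · intro z hz
    rw [aeval_map_eq] at hz
    exact norm_lt_one_of_isDistinguishedAt hP hz
  · intro z hz hGz H hHz
    -- The remainder of `H` under division by `G` vanishes at `z` and has degree below that of the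
    -- minimal polynomial of `z`, so it is zero.
    obtain ⟨q, r, hqr⟩ := PowerSeries.exists_isWeierstrassDivision H hG0
    have hr : r.eval₂ (intHom p) z = 0 := by
      have h1 := hHz
      rw [hqr.eq_mul_add, map_add, map_mul, hGz, zero_mul, zero_add, evalHom_coe] at h1
      exact h1
    have hdvd : P.map (algebraMap ℤ_[p] ℚ_[p]) ∣ r.map (algebraMap ℤ_[p] ℚ_[p]) := by
      rw [minpoly.eq_of_irreducible_of_monic hirr ((hiff z hz).mp hGz) (hP.monic.map _)]
      exact minpoly.dvd _ _ (by rw [aeval_map_eq, hr])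
    have hlt : r.degree < d := by
      have h1 := hqr.degree_lt
      have h2 : (red G).order.toNat = d := by rw [hG]; rfl
      exact lt_of_lt_of_eq h1 (by rw [← h2]; rfl)
    have hinj : Function.Injective (algebraMap ℤ_[p] ℚ_[p]) := IsFractionRing.injective _ _
    have hr0 : r.map (algebraMap ℤ_[p] ℚ_[p]) = 0 := by
      refine Polynomial.eq_zero_of_dvd_of_degree_lt hdvd ?_
      rw [Polynomial.degree_map_eq_of_injective hinj, hP.monic.degree_map,
        Polynomial.degree_eq_natDegree hP.monic.ne_zero, hdeg]
      exact hlt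
    rw [Polynomial.map_eq_zero_iff hinj] at hr0
    refine ⟨q, ?_⟩
    have h1 := hqr.eq_mul_add
    rwa [hr0, Polynomial.coe_zero, add_zero] at h1

theorem ncard_roots {Q : Polynomial ℚ_[p]} (hQ : Irreducible Q) :
    (Q.rootSet ℂ_[p]).ncard = Q.natDegree := by
  rw [← Nat.card_coe_set_eq, Nat.card_eq_fintype_card]
  exact Polynomial.card_rootSet_eq_natDegree hQ.separable (IsAlgClosed.splits _)

end Dyn

namespace Dyn

/-! ### Formal properties of composition -/

namespace S0

variable {R : Type*} [CommRing R]

theorem subst_mul_series (G H : R⟦X⟧) (h : S0 R) :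
    ((G * H).subst h.series : R⟦X⟧) = G.subst h.series * H.subst h.series :=
  PowerSeries.subst_mul h.hasSubst G H

theorem subst_X_series (h : S0 R) : ((PowerSeries.X : R⟦X⟧).subst h.series : R⟦X⟧) = h.series :=
  PowerSeries.subst_X h.hasSubst

theorem coeff_subst (G : R⟦X⟧) (h : S0 R) (n : ℕ) :
    PowerSeries.coeff n (G.subst h.series : R⟦X⟧) =
      ∑ d ∈ Finset.range (n + 1),
        PowerSeries.coeff d G * PowerSeries.coeff n (h.series ^ d) := by
  rw [PowerSeries.coeff_subst' h.hasSubst, finsum_eq_sum_of_support_subset]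
  · rfl
  · intro d hd
    simp only [Finset.coe_range, Set.mem_Iio]
    by_contra hlt
    exact hd (by simp [coeff_pow_of_lt h (show n < d by omega)])

theorem constantCoeff_subst_series (G : R⟦X⟧) (h : S0 R) :
    PowerSeries.constantCoeff (G.subst h.series : R⟦X⟧) = PowerSeries.constantCoeff G := by
  have := coeff_subst G h 0
  simpa using this

/-- The power series `f(x) / x`. -/
def divX (f : S0 R) : R⟦X⟧ := PowerSeries.mk fun n => PowerSeries.coeff (n + 1) f.series

theorem X_mul_divX (f : S0 R) : PowerSeries.X * f.divX = f.series := by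
  ext n
  cases n with
  | zero => simp [f.constantCoeff_eq_zero]
  | succ n => rw [mul_comm, PowerSeries.coeff_succ_mul_X, divX, PowerSeries.coeff_mk]

theorem constantCoeff_divX (f : S0 R) : PowerSeries.constantCoeff f.divX = f.deriv0 := by
  rw [← PowerSeries.coeff_zero_eq_constantCoeff_apply, divX, PowerSeries.coeff_mk, deriv0]

theorem coeff_one_X_mul (G : R⟦X⟧) :
    PowerSeries.coeff 1 (PowerSeries.X * G) = PowerSeries.constantCoeff G := by
  rw [mul_comm, PowerSeries.coeff_succ_mul_X, PowerSeries.coeff_zero_eq_constantCoeff_apply]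

theorem coeff_one_series_mul (f : S0 R) (G : R⟦X⟧) :
    PowerSeries.coeff 1 (f.series * G) = f.deriv0 * PowerSeries.constantCoeff G := by
  rw [← f.X_mul_divX, mul_assoc, coeff_one_X_mul, map_mul, constantCoeff_divX]

theorem series_mul_eq (g h : S0 R) : (g * h).series = h.series * g.divX.subst h.series := by
  rw [series_mul]
  conv_lhs => rw [← g.X_mul_divX]
  rw [subst_mul_series, subst_X_series]

theorem deriv0_mul (g h : S0 R) : (g * h).deriv0 = g.deriv0 * h.deriv0 := by
  rw [deriv0, series_mul_eq, coeff_one_series_mul, constantCoeff_subst_series, constantCoeff_divX,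
    mul_comm]

theorem deriv0_one : (1 : S0 R).deriv0 = 1 := by
  rw [deriv0, series_one, PowerSeries.coeff_one_X]

theorem deriv0_pow (g : S0 R) (n : ℕ) : (g ^ n).deriv0 = g.deriv0 ^ n := by
  induction n with
  | zero => rw [pow_zero, pow_zero, deriv0_one]
  | succ n ih => rw [pow_succ, pow_succ, deriv0_mul, ih]

/-- `G(g) - G(h)` is divisible by `g - h`. -/
theorem exists_subst_sub_subst (G : R⟦X⟧) (g h : S0 R) :
    ∃ S : R⟦X⟧, (G.subst g.series : R⟦X⟧) - G.subst h.series = (g.series - h.series) * S ∧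
      PowerSeries.constantCoeff S = PowerSeries.coeff 1 G := by
  -- `s n` is the cofactor of `g - h` in `g^n - h^n`. It is divisible by `x^(n-1)`, so in degree `m`
  -- the sum of the `Gₙ s n` involves only `n ≤ m + 1`, which is how `S` is defined.
  set s : ℕ → R⟦X⟧ := fun n => ∑ i ∈ Finset.range n, g.series ^ i * h.series ^ (n - 1 - i) with hs
  have hs1 : ∀ n, s n * (g.series - h.series) = g.series ^ n - h.series ^ n := fun n =>
    (Commute.all g.series h.series).geom_sum₂_mul n
  have hs2 : ∀ n m, m + 1 < n → PowerSeries.coeff m (s n) = 0 := by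
    intro n m hm
    have hX : (PowerSeries.X : R⟦X⟧) ^ (n - 1) ∣ s n := by
      refine Finset.dvd_sum fun i hi => ?_
      rw [Finset.mem_range] at hi
      have h1 : n - 1 = i + (n - 1 - i) := by omega
      conv_lhs => rw [h1]
      rw [pow_add]
      exact mul_dvd_mul (pow_dvd_pow_of_dvd (PowerSeries.X_dvd_iff.mpr g.constantCoeff_eq_zero) _)
        (pow_dvd_pow_of_dvd (PowerSeries.X_dvd_iff.mpr h.constantCoeff_eq_zero) _)
    exact PowerSeries.X_pow_dvd_iff.mp hX m (by omega)
  set S : R⟦X⟧ := PowerSeries.mk fun m =>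
    ∑ n ∈ Finset.range (m + 2), PowerSeries.coeff n G * PowerSeries.coeff m (s n) with hS
  have hSj : ∀ m j, j ≤ m → PowerSeries.coeff j S = PowerSeries.coeff j
      (∑ n ∈ Finset.range (m + 2), PowerSeries.C (PowerSeries.coeff n G) * s n) := by
    intro m j hj
    rw [hS, PowerSeries.coeff_mk, map_sum]
    simp only [PowerSeries.coeff_C_mul]
    refine Finset.sum_subset (Finset.range_mono (by omega)) fun n _ hn => ?_
    rw [hs2 n j (by rw [Finset.mem_range] at hn; omega), mul_zero]
  refine ⟨S, ?_, ?_⟩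
  · ext m
    have h1 : PowerSeries.coeff m ((g.series - h.series) * S) =
        PowerSeries.coeff m ((g.series - h.series) *
          ∑ n ∈ Finset.range (m + 2), PowerSeries.C (PowerSeries.coeff n G) * s n) := by
      rw [PowerSeries.coeff_mul, PowerSeries.coeff_mul]
      refine Finset.sum_congr rfl fun ij hij => ?_
      rw [hSj m ij.2 (by have := Finset.HasAntidiagonal.mem_antidiagonal.mp hij; omega)]
    rw [h1, Finset.mul_sum, map_sum, map_sub, coeff_subst, coeff_subst, ← Finset.sum_sub_distrib,
      Finset.sum_range_succ _ (m + 1)]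
    have h2 : ∀ n, PowerSeries.coeff m ((g.series - h.series) *
        (PowerSeries.C (PowerSeries.coeff n G) * s n)) =
        PowerSeries.coeff n G * PowerSeries.coeff m (g.series ^ n) -
          PowerSeries.coeff n G * PowerSeries.coeff m (h.series ^ n) := by
      intro n
      rw [mul_left_comm, mul_comm (_ - _), hs1, PowerSeries.coeff_C_mul, map_sub, mul_sub]
    rw [h2 (m + 1), coeff_pow_of_lt g (Nat.lt_succ_self m), coeff_pow_of_lt h (Nat.lt_succ_self m)]
    simp only [h2]
    simp
  · rw [← PowerSeries.coeff_zero_eq_constantCoeff_apply, hS, PowerSeries.coeff_mk]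
    simp [Finset.sum_range_succ, hs]

/-- A series commuting with `f` is determined by its linear coefficient. -/
theorem eq_of_deriv0_eq [IsDomain R] {f : S0 R} (h0 : f.deriv0 ≠ 0) (h1 : ¬ IsUnit f.deriv0)
    {g h : S0 R} (hg : Commute f g) (hh : Commute f h) (hgh : g.deriv0 = h.deriv0) : g = h := by
  by_contra hne
  have hD : g.series - h.series ≠ 0 := fun h => hne (S0.ext (sub_eq_zero.mp h))
  obtain ⟨S, hS, hS0⟩ := exists_subst_sub_subst f.series g h
  set D := g.series - h.series with hDdef
  set D' := PowerSeries.divXPowOrder D with hD'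
  set n := D.order.toNat with hn
  have hDX : D = PowerSeries.X ^ n * D' := PowerSeries.X_pow_order_mul_divXPowOrder.symm
  have hn2 : 2 ≤ n := by
    by_contra hlt
    have h2 := PowerSeries.coeff_order hD
    rw [← hn] at h2
    have h3 : n = 0 ∨ n = 1 := by omega
    rcases h3 with h3 | h3 <;> rw [h3] at h2 <;> apply h2
    · simp [hDdef, g.constantCoeff_eq_zero, h.constantCoeff_eq_zero]
    · rw [hDdef, map_sub, sub_eq_zero]; exact hgh
  -- Since `g` and `h` commute with `f`, `D ∘ f = f ∘ g - f ∘ h = D S` with `S(0) = f'(0)`.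
  -- Comparing lowest coefficients gives `f'(0)^n = f'(0)` with `n ≥ 2`, impossible for a nonzero
  -- nonunit.
  have hsub : (D.subst f.series : R⟦X⟧) = D * S := by
    rw [← hS, hDdef, PowerSeries.subst_sub f.hasSubst]
    exact congrArg₂ (· - ·) (congrArg S0.series hg.eq.symm) (congrArg S0.series hh.eq.symm)
  have hpow : ((PowerSeries.X ^ n : R⟦X⟧).subst f.series : R⟦X⟧) = f.series ^ n := by
    rw [PowerSeries.subst_pow f.hasSubst, subst_X_series]
  rw [hDX, subst_mul_series, hpow, ← f.X_mul_divX, mul_pow, mul_assoc, mul_assoc] at hsub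
  have hc := mul_left_cancel₀ (pow_ne_zero n PowerSeries.X_ne_zero) hsub
  have hc' := congrArg PowerSeries.constantCoeff hc
  rw [f.X_mul_divX, map_mul, map_mul, map_pow, constantCoeff_subst_series, hS0,
    constantCoeff_divX, mul_comm] at hc'
  have hD0 : PowerSeries.constantCoeff D' ≠ 0 := fun h =>
    hD (PowerSeries.constantCoeff_divXPowOrder_eq_zero_iff.mp h)
  have h2 : f.deriv0 ^ n = f.deriv0 := mul_left_cancel₀ hD0 hc'
  obtain ⟨m, hm⟩ : ∃ m, n = m + 2 := ⟨n - 2, by omega⟩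
  rw [hm, show m + 2 = (m + 1) + 1 from rfl, pow_succ] at h2
  have h3 : f.deriv0 ^ (m + 1) = 1 := mul_right_cancel₀ h0 (h2.trans (one_mul _).symm)
  exact h1 (IsUnit.of_pow_eq_one h3 (by omega))

/-- The factor `f^{∘(n+1)} / f^{∘n}`. -/
def factor (f : S0 R) (n : ℕ) : R⟦X⟧ := f.divX.subst (f ^ n).series

theorem series_pow_succ (f : S0 R) (n : ℕ) :
    (f ^ (n + 1)).series = (f ^ n).series * f.factor n := by
  rw [pow_succ', series_mul_eq]; rfl

theorem constantCoeff_factor (f : S0 R) (n : ℕ) :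
    PowerSeries.constantCoeff (f.factor n) = f.deriv0 := by
  rw [factor, constantCoeff_subst_series, constantCoeff_divX]

end S0

end Dyn

namespace Dyn

variable {p : ℕ} [Fact p.Prime]

open IsLocalRing

/-! ### Roots of the iterates of a series of height one -/

/-- Series of height one whose linear coefficient is a uniformizer. -/
structure IsHeightOne (f : S0 ℤ_[p]) : Prop where
  order_red : (red f.series).order = p
  norm_deriv0 : ‖f.deriv0‖ = ‖(p : ℤ_[p])‖

theorem notMem_maximalIdeal_sq {a : ℤ_[p]} (ha : ‖a‖ = ‖(p : ℤ_[p])‖) :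
    a ∉ maximalIdeal ℤ_[p] ^ 2 := by
  have hp1 : (1 : ℝ) < p := by exact_mod_cast (Fact.out : p.Prime).one_lt
  rw [PadicInt.maximalIdeal_eq_span_p, Ideal.span_singleton_pow,
    ← PadicInt.norm_le_pow_iff_mem_span_pow, ha, PadicInt.norm_p, ← zpow_neg_one, not_le]
  exact zpow_lt_zpow_right₀ hp1 (by norm_num)

theorem norm_p_pos : 0 < ‖(p : ℤ_[p])‖ := norm_pos_iff.mpr PadicInt.prime_p.ne_zero

theorem norm_deriv0_of_valuation {f : S0 ℤ_[p]} (h : f.deriv0.valuation = 1) :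
    ‖f.deriv0‖ = ‖(p : ℤ_[p])‖ := by
  have h0 : f.deriv0 ≠ 0 := by
    intro h0; rw [h0, PadicInt.valuation_zero] at h; exact zero_ne_one h
  rw [PadicInt.norm_eq_zpow_neg_valuation h0, h, PadicInt.norm_p]
  simp

theorem deriv0_ne_zero_of_norm {f : S0 ℤ_[p]} (hf : ‖f.deriv0‖ = ‖(p : ℤ_[p])‖) :
    f.deriv0 ≠ 0 := norm_pos_iff.mp (hf ▸ norm_p_pos)

theorem norm_deriv0_lt_one {f : S0 ℤ_[p]} (hf : ‖f.deriv0‖ = ‖(p : ℤ_[p])‖) :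
    ‖f.deriv0‖ < 1 := by
  rw [hf]; exact PadicInt.mem_nonunits.mp PadicInt.prime_p.not_isUnit

theorem not_isUnit_deriv0 {f : S0 ℤ_[p]} (hf : ‖f.deriv0‖ = ‖(p : ℤ_[p])‖) :
    ¬ IsUnit f.deriv0 := by
  rw [PadicInt.isUnit_iff]; exact (norm_deriv0_lt_one hf).ne

theorem red_series_eq (f : S0 ℤ_[p]) : red f.series = PowerSeries.X * red f.divX := by
  rw [← f.X_mul_divX, map_mul]
  congr 1
  exact PowerSeries.map_X _

theorem eval_eq_mul_divX (f : S0 ℤ_[p]) {z : ℂ_[p]} (hz : ‖z‖ < 1) :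
    eval f z = z * evalHom z hz f.divX := by
  rw [eval_eq_evalHom f hz, ← f.X_mul_divX, map_mul, evalHom_X]

theorem order_ne_zero_of_norm {G : ℤ_[p]⟦X⟧} (hG : ‖PowerSeries.constantCoeff G‖ < 1) :
    (red G).order ≠ 0 := by
  rw [PowerSeries.order_ne_zero_iff_constCoeff_eq_zero,
    ← PowerSeries.coeff_zero_eq_constantCoeff_apply, coeff_red, residue_eq_zero_iff,
    PowerSeries.coeff_zero_eq_constantCoeff_apply]
  exact PadicInt.mem_nonunits.mpr hG

theorem evalHom_eq_intHom_of_zero (G : ℤ_[p]⟦X⟧) (h0 : ‖(0 : ℂ_[p])‖ < 1) :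
    evalHom 0 h0 G = intHom p (PowerSeries.constantCoeff G) := by
  rw [evalHom_apply, tsum_eq_single 0]
  · simp
  · intro n hn
    rw [zero_pow hn, mul_zero]

/-- The zeros of `f/x` in the disk are those of an Eisenstein polynomial: nonzero, simple, and as
many as the order of `f/x` modulo `p`. The root `0` supplies one more. -/
theorem isHeightOne_of_ncard_roots {f : S0 ℤ_[p]} (hval : f.deriv0.valuation = 1)
    (hcard : {x : ℂ_[p] | ‖x‖ < 1 ∧ eval f x = 0}.ncard = p) : IsHeightOne f := by
  have hnorm := norm_deriv0_of_valuation hval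
  refine ⟨?_, hnorm⟩
  have h00 : ‖(0 : ℂ_[p])‖ < 1 := by rw [norm_zero]; exact one_pos
  -- Otherwise `f/x` would be `p` times a unit and `0` the only root of `f`, whereas `p > 1`.
  have hdiv0 : red f.divX ≠ 0 := by
    intro h
    obtain ⟨H, hH⟩ := (red_eq_zero_iff _).mp h
    have hU : IsUnit H := by
      rw [PowerSeries.isUnit_iff_constantCoeff, PadicInt.isUnit_iff]
      have h1 := congrArg (fun G => ‖PowerSeries.constantCoeff G‖) hH
      simp only [S0.constantCoeff_divX, map_mul, PowerSeries.constantCoeff_C, norm_mul] at h1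
      rw [hnorm] at h1
      exact mul_left_cancel₀ norm_p_pos.ne' (h1.symm.trans (mul_one _).symm)
    have hset : {x : ℂ_[p] | ‖x‖ < 1 ∧ eval f x = 0} = {0} := by
      ext x
      simp only [Set.mem_ofPred_eq, Set.mem_singleton_iff]
      constructor
      · rintro ⟨hx, hfx⟩
        rw [eval_eq_mul_divX f hx, hH, map_mul, mul_eq_zero, mul_eq_zero] at hfx
        rcases hfx with h2 | h2 | h2
        · exact h2
        · exact absurd h2 (evalHom_C_p_ne_zero hx)
        · exact absurd h2 (evalHom_ne_zero_of_isUnit hx hU)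
      · rintro rfl
        exact ⟨h00, eval_zero f⟩
    rw [hset, Set.ncard_singleton] at hcard
    exact (Fact.out : p.Prime).one_lt.ne hcard
  set d := (red f.divX).order.toNat with hd
  have hd' : (red f.divX).order = d := (PowerSeries.coe_toNat_order hdiv0).symm
  have hd0 : 0 < d := by
    have h1 := order_ne_zero_of_norm (G := f.divX) (by
      rw [f.constantCoeff_divX]; exact norm_deriv0_lt_one hnorm)
    rw [hd'] at h1
    exact Nat.pos_of_ne_zero fun h => h1 (by rw [h]; rfl)
  obtain ⟨Q, hQ, hQm, hQd, hQdisk, hQz, -⟩ := exists_irreducible_of_eisenstein hd0 hd'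
    (by rw [f.constantCoeff_divX]; exact notMem_maximalIdeal_sq hnorm)
  have hset : {x : ℂ_[p] | ‖x‖ < 1 ∧ eval f x = 0} = insert 0 (Q.rootSet ℂ_[p]) := by
    ext x
    simp only [Set.mem_ofPred_eq, Set.mem_insert_iff, Polynomial.mem_rootSet_of_ne hQ.ne_zero]
    constructor
    · rintro ⟨hx, hfx⟩
      rwa [eval_eq_mul_divX f hx, mul_eq_zero, hQz x hx] at hfx
    · rintro (rfl | hx)
      · exact ⟨h00, eval_zero f⟩
      · have hx1 := hQdisk x hx
        exact ⟨hx1, by rw [eval_eq_mul_divX f hx1, (hQz x hx1).mpr hx, mul_zero]⟩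
  have h0 : (0 : ℂ_[p]) ∉ Q.rootSet ℂ_[p] := by
    rw [Polynomial.mem_rootSet_of_ne hQ.ne_zero, ← hQz 0 h00, evalHom_eq_intHom_of_zero,
      f.constantCoeff_divX, map_eq_zero_iff _ intHom_injective]
    exact deriv0_ne_zero_of_norm hnorm
  rw [hset, Set.ncard_insert_of_notMem h0 (Q.rootSet_finite ℂ_[p]), ncard_roots hQ, hQd] at hcard
  rw [red_series_eq, PowerSeries.order_mul, PowerSeries.order_X, hd', ← hcard, add_comm]
  norm_cast

namespace IsHeightOne

variable {f : S0 ℤ_[p]}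

theorem order_red_divX (hf : IsHeightOne f) : (red f.divX).order = ((p - 1 : ℕ) : ℕ∞) := by
  have h1 := hf.order_red
  rw [red_series_eq, PowerSeries.order_mul, PowerSeries.order_X] at h1
  have h2 : (p : ℕ∞) = 1 + ((p - 1 : ℕ) : ℕ∞) := by
    have := (Fact.out : p.Prime).one_lt
    exact_mod_cast (show p = 1 + (p - 1) by omega)
  rw [h2] at h1
  exact WithTop.add_left_cancel (by exact ENat.one_ne_top) h1

theorem red_ne_zero (hf : IsHeightOne f) : red f.series ≠ 0 := by
  intro h
  have h1 := hf.order_red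
  rw [h, PowerSeries.order_zero] at h1
  exact ENat.top_ne_natCast p h1

theorem red_divX_ne_zero (hf : IsHeightOne f) : red f.divX ≠ 0 := by
  intro h
  apply hf.red_ne_zero
  rw [red_series_eq, h, mul_zero]

theorem order_red_pow (hf : IsHeightOne f) (n : ℕ) :
    (red (f ^ n).series).order = ((p ^ n : ℕ) : ℕ∞) := by
  induction n with
  | zero =>
    rw [pow_zero, pow_zero, S0.series_one, red, PowerSeries.map_X, PowerSeries.order_X]; rfl
  | succ n ih =>
    rw [pow_succ', S0.series_mul, order_red_subst _ _ hf.red_ne_zero, ih, hf.order_red, pow_succ']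
    norm_cast

theorem red_pow_ne_zero (hf : IsHeightOne f) (n : ℕ) : red (f ^ n).series ≠ 0 := by
  intro h
  have h1 := hf.order_red_pow n
  rw [h, PowerSeries.order_zero] at h1
  exact ENat.top_ne_natCast _ h1

theorem order_red_factor (hf : IsHeightOne f) (n : ℕ) :
    (red (f.factor n)).order = (((p - 1) * p ^ n : ℕ) : ℕ∞) := by
  rw [S0.factor, order_red_subst _ _ hf.red_divX_ne_zero, hf.order_red_pow, hf.order_red_divX]
  norm_cast

end IsHeightOne

/-- The points of the open unit disk killed by `f^{∘(n+1)}`, but not by `f^{∘n}`. -/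
def level (f : S0 ℤ_[p]) (n : ℕ) : Set ℂ_[p] :=
  {z | ‖z‖ < 1 ∧ eval (f ^ n) z ≠ 0 ∧ eval (f ^ (n + 1)) z = 0}

theorem eval_pow_succ_eq_mul (f : S0 ℤ_[p]) (n : ℕ) {z : ℂ_[p]} (hz : ‖z‖ < 1) :
    eval (f ^ (n + 1)) z = eval (f ^ n) z * evalHom z hz (f.factor n) := by
  rw [eval_eq_evalHom _ hz, S0.series_pow_succ, map_mul, ← eval_eq_evalHom]

/-- At a zero of `f^{∘n}` the factor takes the value `f'(0) ≠ 0`, so the two have no common zero. -/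
theorem mem_level_iff {f : S0 ℤ_[p]} (hf : f.deriv0 ≠ 0) (n : ℕ) {z : ℂ_[p]} (hz : ‖z‖ < 1) :
    z ∈ level f n ↔ evalHom z hz (f.factor n) = 0 := by
  constructor
  · rintro ⟨-, h1, h2⟩
    rw [eval_pow_succ_eq_mul f n hz] at h2
    exact (mul_eq_zero.mp h2).resolve_left h1
  · intro h
    refine ⟨hz, fun h1 => ?_, by rw [eval_pow_succ_eq_mul f n hz, h, mul_zero]⟩
    have h2 := h
    rw [S0.factor, evalHom_subst] at h2
    simp only [h1] at h2
    rw [evalHom_eq_intHom_of_zero, f.constantCoeff_divX, map_eq_zero_iff _ intHom_injective] at h2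
    exact hf h2

theorem IsHeightOne.exists_irreducible {f : S0 ℤ_[p]} (hf : IsHeightOne f) (n : ℕ) :
    ∃ Q : Polynomial ℚ_[p], Irreducible Q ∧ Q.Monic ∧ Q.natDegree = (p - 1) * p ^ n ∧
      level f n = Q.rootSet ℂ_[p] ∧
      ∀ (z : ℂ_[p]) (hz : ‖z‖ < 1), z ∈ level f n →
        ∀ H, evalHom z hz H = 0 → f.factor n ∣ H := by
  have hp := (Fact.out : p.Prime).one_lt
  obtain ⟨Q, hQ, hQm, hQd, hQdisk, hQz, hdvd⟩ := exists_irreducible_of_eisenstein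
    (Nat.mul_pos (by omega) (pow_pos (by omega) n)) (hf.order_red_factor n)
    (by rw [f.constantCoeff_factor]; exact notMem_maximalIdeal_sq hf.norm_deriv0)
  have h0 := deriv0_ne_zero_of_norm hf.norm_deriv0
  refine ⟨Q, hQ, hQm, hQd, ?_, fun z hz hzl => hdvd z hz ((mem_level_iff h0 n hz).mp hzl)⟩
  ext z
  rw [Polynomial.mem_rootSet_of_ne hQ.ne_zero]
  constructor
  · intro h
    exact (hQz z h.1).mp ((mem_level_iff h0 n h.1).mp h)
  · intro h
    exact (mem_level_iff h0 n (hQdisk z h)).mpr ((hQz z (hQdisk z h)).mpr h)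

theorem IsHeightOne.finite_level {f : S0 ℤ_[p]} (hf : IsHeightOne f) (n : ℕ) :
    (level f n).Finite := by
  obtain ⟨Q, -, -, -, h, -⟩ := hf.exists_irreducible n
  rw [h]; exact Q.rootSet_finite _

theorem IsHeightOne.ncard_level {f : S0 ℤ_[p]} (hf : IsHeightOne f) (n : ℕ) :
    (level f n).ncard = (p - 1) * p ^ n := by
  obtain ⟨Q, hQ, -, hd, h, -⟩ := hf.exists_irreducible n
  rw [h, ncard_roots hQ, hd]

theorem IsHeightOne.factor_dvd {f : S0 ℤ_[p]} (hf : IsHeightOne f) {n : ℕ} {z : ℂ_[p]}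
    (hz : ‖z‖ < 1) (hzl : z ∈ level f n) {H : ℤ_[p]⟦X⟧} (hH : evalHom z hz H = 0) :
    f.factor n ∣ H := by
  obtain ⟨Q, -, -, -, -, h⟩ := hf.exists_irreducible n
  exact h z hz hzl H hH

/-- The quotient `f(z)/z` is `f'(0)` plus a multiple of `z`, hence of norm below `1`. -/
theorem norm_eval_lt {f : S0 ℤ_[p]} (hf : ‖f.deriv0‖ < 1) {z : ℂ_[p]} (hz : ‖z‖ < 1)
    (hz0 : z ≠ 0) : ‖eval f z‖ < ‖z‖ := by
  rw [eval_eq_mul_divX f hz, norm_mul]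
  refine mul_lt_of_lt_one_right (norm_pos_iff.mpr hz0) ?_
  obtain ⟨G, hG⟩ : PowerSeries.X ∣ f.divX - PowerSeries.C f.deriv0 := by
    rw [PowerSeries.X_dvd_iff, map_sub, f.constantCoeff_divX, PowerSeries.constantCoeff_C, sub_self]
  rw [sub_eq_iff_eq_add.mp hG, map_add, map_mul, evalHom_X, evalHom_C]
  refine (IsUltrametricDist.norm_add_le_max _ _).trans_lt (max_lt ?_ ?_)
  · rw [norm_mul]
    exact (mul_le_of_le_one_right (norm_nonneg _) (norm_evalHom_le_one hz G)).trans_lt hz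
  · rwa [norm_intHom]

/-! ### Towers of preimages of zero -/

/-- A sequence `0, π₁, π₂, …` of iterated preimages of `0` with `π₁ ≠ 0`. -/
structure IsTower (f : S0 ℤ_[p]) (ψ : ℕ → ℂ_[p]) : Prop where
  norm_lt_one : ∀ i, ‖ψ i‖ < 1
  zero : ψ 0 = 0
  one_ne_zero : ψ 1 ≠ 0
  eval_succ : ∀ i, eval f (ψ (i + 1)) = ψ i

namespace IsTower

variable {f : S0 ℤ_[p]} {ψ : ℕ → ℂ_[p]}

theorem eval_pow (hψ : IsTower f ψ) (n j : ℕ) : eval (f ^ n) (ψ (n + j)) = ψ j := by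
  induction n with
  | zero => rw [pow_zero, eval_one (hψ.norm_lt_one _), zero_add]
  | succ n ih =>
    rw [pow_succ, eval_mul _ _ (hψ.norm_lt_one _), show n + 1 + j = n + j + 1 by omega,
      hψ.eval_succ, ih]

theorem ne_zero (hψ : IsTower f ψ) (n : ℕ) : ψ (n + 1) ≠ 0 := by
  intro h
  have h1 := hψ.eval_pow n 1
  rw [h, eval_zero] at h1
  exact hψ.one_ne_zero h1.symm

theorem injective (hψ : IsTower f ψ) : Function.Injective ψ := by
  have key : ∀ i j, ψ i = ψ (i + (j + 1)) → False := by
    intro i j h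
    have h1 := hψ.eval_pow i (j + 1)
    have h2 := hψ.eval_pow i 0
    rw [add_zero] at h2
    rw [← h, h2, hψ.zero] at h1
    exact hψ.ne_zero j h1.symm
  intro i j h
  rcases lt_trichotomy i j with hij | hij | hij
  · obtain ⟨m, rfl⟩ : ∃ m, j = i + (m + 1) := ⟨j - i - 1, by omega⟩
    exact (key _ _ h).elim
  · exact hij
  · obtain ⟨m, rfl⟩ : ∃ m, i = j + (m + 1) := ⟨i - j - 1, by omega⟩
    exact (key _ _ h.symm).elim

theorem mem_level (hψ : IsTower f ψ) (n : ℕ) : ψ (n + 1) ∈ level f n := by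
  refine ⟨hψ.norm_lt_one _, ?_, ?_⟩
  · rw [hψ.eval_pow]; exact hψ.one_ne_zero
  · have := hψ.eval_pow (n + 1) 0
    rwa [add_zero, hψ.zero] at this

/-- The factors are split off one at a time: `f^{∘n}` takes the nonzero value `ψ 1` at `ψ (n + 1)`,
so the remaining cofactor vanishes there and is divisible by `f.factor n`. -/
theorem pow_dvd (hf : IsHeightOne f) (hψ : IsTower f ψ) (n : ℕ) {H : ℤ_[p]⟦X⟧}
    (hH : ∀ i ≤ n, evalHom (ψ i) (hψ.norm_lt_one i) H = 0) : (f ^ n).series ∣ H := by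
  induction n with
  | zero =>
    rw [pow_zero, S0.series_one, PowerSeries.X_dvd_iff]
    have h := hH 0 le_rfl
    simp only [hψ.zero] at h
    rwa [evalHom_eq_intHom_of_zero, map_eq_zero_iff _ intHom_injective] at h
  | succ n ih =>
    obtain ⟨H', rfl⟩ := ih fun i hi => hH i (by omega)
    rw [S0.series_pow_succ]
    refine mul_dvd_mul_left _ (hf.factor_dvd (hψ.norm_lt_one (n + 1)) (hψ.mem_level n) ?_)
    have h := hH (n + 1) le_rfl
    rw [map_mul, ← eval_eq_evalHom, hψ.eval_pow] at h
    exact (mul_eq_zero.mp h).resolve_left hψ.one_ne_zero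

end IsTower

/-! ### Fixed points of series commuting with a series of height one -/

theorem eval_comm {f g : S0 ℤ_[p]} (h : Commute f g) {z : ℂ_[p]} (hz : ‖z‖ < 1) :
    eval f (eval g z) = eval g (eval f z) := by
  rw [← eval_mul _ _ hz, h.eq, eval_mul _ _ hz]

theorem eval_eq_self_iff (g : S0 ℤ_[p]) {z : ℂ_[p]} (hz : ‖z‖ < 1) :
    eval g z = z ↔ evalHom z hz (g.series - PowerSeries.X) = 0 := by
  rw [map_sub, evalHom_X, eval_eq_evalHom g hz, sub_eq_zero]

theorem series_sub_X_ne_zero {g : S0 ℤ_[p]} (hg : g ≠ 1) : g.series - PowerSeries.X ≠ 0 :=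
  fun h => hg (S0.ext (sub_eq_zero.mp h))

theorem finite_fixedPoints {g : S0 ℤ_[p]} (hg : g ≠ 1) :
    {z : ℂ_[p] | ‖z‖ < 1 ∧ eval g z = z}.Finite :=
  (finite_zeros (series_sub_X_ne_zero hg)).subset fun _ hz =>
    ⟨hz.1, (eval_eq_self_iff g hz.1).mp hz.2⟩

theorem coeff_one_sub_X (g : S0 ℤ_[p]) :
    PowerSeries.coeff 1 (g.series - PowerSeries.X) = g.deriv0 - 1 := by
  rw [map_sub, PowerSeries.coeff_one_X]; rfl

theorem coeff_one_C_mul_pow_mul {f : S0 ℤ_[p]} (m n : ℕ) (G : ℤ_[p]⟦X⟧) :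
    PowerSeries.coeff 1 (PowerSeries.C (p : ℤ_[p]) ^ m * ((f ^ n).series * G)) =
      (p : ℤ_[p]) ^ m * (f.deriv0 ^ n * PowerSeries.constantCoeff G) := by
  rw [← map_pow, PowerSeries.coeff_C_mul, S0.coeff_one_series_mul, S0.deriv0_pow]

/-- In `g^{t+1} - x = (g^t ∘ g - g^t) + (g^t - x)` the first bracket is a multiple of `g - x`. -/
theorem dvd_series_pow_sub_X {g : S0 ℤ_[p]} {a : ℤ_[p]⟦X⟧}
    (h : a ∣ g.series - PowerSeries.X) (t : ℕ) : a ∣ (g ^ t).series - PowerSeries.X := by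
  induction t with
  | zero => rw [pow_zero, S0.series_one, sub_self]; exact dvd_zero a
  | succ t ih =>
    obtain ⟨S, hS, -⟩ := S0.exists_subst_sub_subst (g ^ t).series g 1
    have h1 : (g ^ (t + 1)).series - PowerSeries.X =
        (g.series - PowerSeries.X) * S + ((g ^ t).series - PowerSeries.X) := by
      have h2 : ((g ^ t).series.subst (1 : S0 ℤ_[p]).series : ℤ_[p]⟦X⟧) = (g ^ t).series := by
        rw [← S0.series_mul, mul_one]
      rw [h2, S0.series_one] at hS
      rw [← hS, pow_succ, S0.series_mul]
      ring
    rw [h1]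
    exact dvd_add (h.mul_right _) ih

theorem norm_deriv0_sub_one_le {f : S0 ℤ_[p]} {ψ : ℕ → ℂ_[p]} (hf : IsHeightOne f)
    (hψ : IsTower f ψ) {g : S0 ℤ_[p]} {m n : ℕ}
    (hm : PowerSeries.C (p : ℤ_[p]) ^ m ∣ g.series - PowerSeries.X)
    (hfix : ∀ i ≤ n, eval g (ψ i) = ψ i) :
    ‖g.deriv0 - 1‖ ≤ ‖(p : ℤ_[p])‖ ^ (m + n) := by
  obtain ⟨H, hH⟩ := hm
  obtain ⟨G, rfl⟩ := hψ.pow_dvd hf n (H := H) fun i hi => by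
    have h := (eval_eq_self_iff g (hψ.norm_lt_one i)).mp (hfix i hi)
    rw [hH, map_mul, map_pow] at h
    exact (mul_eq_zero.mp h).resolve_left (pow_ne_zero _ (evalHom_C_p_ne_zero _))
  rw [← coeff_one_sub_X, hH, coeff_one_C_mul_pow_mul, norm_mul, norm_mul, norm_pow, norm_pow,
    hf.norm_deriv0, pow_add]
  exact mul_le_mul_of_nonneg_left
    (mul_le_of_le_one_right (by positivity) (PadicInt.norm_le_one _)) (by positivity)

/-- Otherwise the points `f^{∘i}(z)`, all fixed by `g`, would have strictly decreasing norms, giving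
infinitely many fixed points. -/
theorem exists_eval_pow_eq_zero {f g : S0 ℤ_[p]} (hf : ‖f.deriv0‖ < 1) (hfg : Commute f g)
    (hg : g ≠ 1) {z : ℂ_[p]} (hz : ‖z‖ < 1) (hgz : eval g z = z) :
    ∃ i, eval (f ^ i) z = 0 := by
  by_contra! hne
  have hlt : ∀ i, ‖eval (f ^ i) z‖ < 1 := fun i => norm_eval_lt_one _ hz
  have hanti : StrictAnti fun i => ‖eval (f ^ i) z‖ := by
    refine strictAnti_nat_of_succ_lt fun i => ?_
    rw [pow_succ', eval_mul _ _ hz]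
    exact norm_eval_lt hf (hlt i) (hne i)
  have hinj : Function.Injective fun i => eval (f ^ i) z := fun i j h =>
    hanti.injective (congrArg norm h)
  refine Set.infinite_of_injective_forall_mem hinj (fun i => ?_) (finite_fixedPoints hg)
  refine ⟨hlt i, ?_⟩
  rw [← eval_comm (hfg.pow_left i) hz, hgz]

/-- In `g - x = p^m f^{∘k} w` the crux is that `w` is a unit. A zero of `w` would be a fixed point
of `g` killed by `f^{∘k}`, thus a repeated zero of `H`, and commutation with `f^{∘k}` would then
force `g'(0) = 1`. -/
theorem norm_deriv0_sub_one_eq {f : S0 ℤ_[p]} {ψ : ℕ → ℂ_[p]} (hf : IsHeightOne f)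
    (hψ : IsTower f ψ) {g : S0 ℤ_[p]} (hfg : Commute f g) (hg : g ≠ 1) {m k : ℕ} {H : ℤ_[p]⟦X⟧}
    (hH : red H ≠ 0) (hm : g.series - PowerSeries.X = PowerSeries.C (p : ℤ_[p]) ^ m * H)
    (hfix : ∀ i, eval g (ψ i) = ψ i ↔ i ≤ k) :
    ‖g.deriv0 - 1‖ = ‖(p : ℤ_[p])‖ ^ (m + k) := by
  have hHzero : ∀ z (hz : ‖z‖ < 1), evalHom z hz H = 0 ↔ eval g z = z := by
    intro z hz
    rw [eval_eq_self_iff g hz, hm, map_mul, map_pow, mul_eq_zero,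
      or_iff_right (pow_ne_zero _ (evalHom_C_p_ne_zero hz))]
  obtain ⟨w, rfl⟩ := hψ.pow_dvd hf k (H := H) fun i hi => (hHzero _ _).mpr ((hfix i).mpr hi)
  have hFk0 : (f ^ k).series ≠ 0 := fun h => hf.red_pow_ne_zero k (by rw [h, map_zero])
  have hw : IsUnit w := by
    by_contra hwu
    have hwred : red w ≠ 0 := fun h => hH (by rw [map_mul, h, mul_zero])
    obtain ⟨z, hz, hwz⟩ := exists_zero hwred hwu
    have hgz : eval g z = z := (hHzero z hz).mp (by rw [map_mul, hwz, mul_zero])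
    have hFkz : eval (f ^ k) z = 0 := by
      classical
      have hex := exists_eval_pow_eq_zero (norm_deriv0_lt_one hf.norm_deriv0) hfg hg hz hgz
      have hspec := Nat.find_spec hex
      have hmin := fun j => Nat.find_min hex (m := j)
      set i := Nat.find hex
      have hik : i ≤ k := by
        cases hi : i with
        | zero => exact Nat.zero_le k
        | succ j =>
          have hlevel : z ∈ level f j :=
            ⟨hz, hmin j (by omega), by rw [← hi]; exact hspec⟩
          -- Vanishing at `z` spreads to its whole level, in particular to `ψ (j + 1)`, which is
          -- therefore fixed by `g`; so `j + 1 ≤ k`.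
          obtain ⟨A, hA⟩ := hf.factor_dvd hz hlevel
            (show evalHom z hz ((f ^ k).series * w) = 0 by rw [map_mul, hwz, mul_zero])
          rw [← hfix, ← hHzero _ (hψ.norm_lt_one _), hA, map_mul,
            (mem_level_iff (deriv0_ne_zero_of_norm hf.norm_deriv0) j _).mp (hψ.mem_level j),
            zero_mul]
      rw [← Nat.sub_add_cancel hik, pow_add, eval_mul _ _ hz, hspec, eval_zero]
    -- Expand `g ∘ f^{∘k} = f^{∘k} ∘ g` about `x` and cancel `f^{∘k}`: this leaves `(g/x) ∘ f^{∘k} -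
    -- 1 = p^m w S`, which at `z` reads `g'(0) - 1 = 0`.
    obtain ⟨S, hS, -⟩ := S0.exists_subst_sub_subst (f ^ k).series g 1
    have h1 : (f ^ k).series * (g.divX.subst (f ^ k).series : ℤ_[p]⟦X⟧) - (f ^ k).series =
        (f ^ k).series * (PowerSeries.C (p : ℤ_[p]) ^ m * w * S) := by
      rw [← S0.series_mul_eq, ← (hfg.pow_left k).eq, S0.series_mul]
      have h2 : ((f ^ k).series.subst (1 : S0 ℤ_[p]).series : ℤ_[p]⟦X⟧) = (f ^ k).series := by
        rw [← S0.series_mul, mul_one]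
      rw [h2, S0.series_one, hm] at hS
      rw [hS]; ring
    have h2 : (g.divX.subst (f ^ k).series : ℤ_[p]⟦X⟧) - 1 = PowerSeries.C (p : ℤ_[p]) ^ m * w * S :=
      mul_left_cancel₀ hFk0 (by rw [mul_sub, mul_one, h1])
    have h3 := congrArg (evalHom z hz) h2
    rw [map_sub, map_one, evalHom_subst, map_mul, map_mul, hwz, mul_zero, zero_mul] at h3
    simp only [hFkz] at h3
    rw [evalHom_eq_intHom_of_zero, S0.constantCoeff_divX, sub_eq_zero, ← map_one (intHom p)] at h3
    exact hg (S0.eq_of_deriv0_eq (deriv0_ne_zero_of_norm hf.norm_deriv0)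
      (not_isUnit_deriv0 hf.norm_deriv0) hfg (Commute.one_right f)
      (by rw [intHom_injective h3, S0.deriv0_one]))
  rw [← coeff_one_sub_X, hm, coeff_one_C_mul_pow_mul, norm_mul, norm_mul, norm_pow, norm_pow,
    hf.norm_deriv0, pow_add]
  rw [PowerSeries.isUnit_iff_constantCoeff, PadicInt.isUnit_iff] at hw
  rw [hw, mul_one]

/-- A power `g ^ t` fixing the `n`-th point of the tower has exponent divisible by `p ^ (n - k)`,
where `k` is the last index fixed by `g`. -/
theorem pow_dvd_of_fixed {f : S0 ℤ_[p]} {ψ : ℕ → ℂ_[p]} (hf : IsHeightOne f)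
    (hψ : IsTower f ψ) {g : S0 ℤ_[p]} (hfg : Commute f g) (hg : g ≠ 1)
    (hnorm : ∀ m : ℕ, ‖1 - g.deriv0 ^ m‖ = ‖1 - g.deriv0‖ * ‖(m : ℤ_[p])‖)
    {k : ℕ} (hfix : ∀ i, eval g (ψ i) = ψ i ↔ i ≤ k)
    {t n : ℕ} (ht : eval (g ^ t) (ψ n) = ψ n) : p ^ (n - k) ∣ t := by
  rcases le_total n k with hnk | hnk
  · rw [Nat.sub_eq_zero_of_le hnk, pow_zero]; exact one_dvd t
  obtain ⟨m, H, hH, hm⟩ := exists_eq_C_pow_mul (series_sub_X_ne_zero hg)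
  have h1 := norm_deriv0_sub_one_eq hf hψ hfg hg hH hm hfix
  have hfixt : ∀ i ≤ n, eval (g ^ t) (ψ i) = ψ i := by
    intro i hi
    have h2 := hψ.eval_pow (n - i) i
    rw [Nat.sub_add_cancel hi] at h2
    rw [← h2, ← eval_comm (hfg.pow_pow _ _) (hψ.norm_lt_one n), ht]
  have h2 := norm_deriv0_sub_one_le hf hψ (dvd_series_pow_sub_X (Dvd.intro _ hm.symm) t) hfixt
  rw [S0.deriv0_pow, norm_sub_rev, hnorm t, norm_sub_rev, h1,
    show m + n = (m + k) + (n - k) by omega, pow_add _ (m + k)] at h2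
  have h3 : ‖(t : ℤ_[p])‖ ≤ ‖(p : ℤ_[p])‖ ^ (n - k) :=
    le_of_mul_le_mul_left h2 (pow_pos norm_p_pos _)
  have h4 : ‖((t : ℤ) : ℤ_[p])‖ ≤ (p : ℝ) ^ (-((n - k : ℕ) : ℤ)) := by
    rw [PadicInt.norm_p, inv_pow] at h3
    rw [zpow_neg, zpow_natCast]
    exact_mod_cast h3
  rw [PadicInt.norm_int_le_pow_iff_dvd] at h4
  exact_mod_cast h4

/-- Applying `f` shows that the fixed indices are closed downwards; they are bounded because `g` has
finitely many fixed points. -/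
theorem exists_fixed_iff_le {f : S0 ℤ_[p]} {ψ : ℕ → ℂ_[p]}
    (hψ : IsTower f ψ) {g : S0 ℤ_[p]} (hfg : Commute f g) (hg : g ≠ 1) :
    ∃ k, ∀ i, eval g (ψ i) = ψ i ↔ i ≤ k := by
  classical
  have hex : ∃ i, eval g (ψ i) ≠ ψ i := by
    by_contra! hall
    exact Set.infinite_of_injective_forall_mem hψ.injective
      (fun i => show ψ i ∈ {z : ℂ_[p] | ‖z‖ < 1 ∧ eval g z = z} from
        ⟨hψ.norm_lt_one i, hall i⟩) (finite_fixedPoints hg)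
  have hspec := Nat.find_spec hex
  have hmin := fun j => Nat.find_min hex (m := j)
  set m := Nat.find hex
  have hm0 : m ≠ 0 := by
    intro h
    rw [h, hψ.zero, eval_zero] at hspec
    exact hspec rfl
  refine ⟨m - 1, fun i => ⟨fun hi => ?_, fun hi => not_not.mp (hmin i (by omega))⟩⟩
  by_contra hlt
  have h2 := hψ.eval_pow (i - m) m
  rw [Nat.sub_add_cancel (by omega)] at h2
  apply hspec
  rw [← h2, ← eval_comm (hfg.pow_left _) (hψ.norm_lt_one i), hi]

theorem eval_injOn (g : (S0 ℤ_[p])ˣ) {x y : ℂ_[p]} (hx : ‖x‖ < 1) (hy : ‖y‖ < 1)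
    (h : eval (g : S0 ℤ_[p]) x = eval (g : S0 ℤ_[p]) y) : x = y := by
  have h1 := congrArg (eval ((g⁻¹ : (S0 ℤ_[p])ˣ) : S0 ℤ_[p])) h
  rwa [← eval_mul _ _ hx, ← eval_mul _ _ hy, Units.inv_mul, eval_one hx, eval_one hy] at h1

theorem eval_mem_level {f : S0 ℤ_[p]} {g : (S0 ℤ_[p])ˣ} (hfg : Commute f (g : S0 ℤ_[p])) {n : ℕ}
    {z : ℂ_[p]} (hz : z ∈ level f n) : eval (g : S0 ℤ_[p]) z ∈ level f n := by
  refine ⟨norm_eval_lt_one _ hz.1, ?_, ?_⟩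
  · rw [eval_comm (hfg.pow_left _) hz.1]
    intro h
    exact hz.2.1 (eval_injOn g (norm_eval_lt_one _ hz.1) (by simp) (h.trans (eval_zero _).symm))
  · rw [eval_comm (hfg.pow_left _) hz.1, hz.2.2, eval_zero]

theorem eval_pow_sub_eq_of_eq (g : (S0 ℤ_[p])ˣ) {x : ℂ_[p]} (hx : ‖x‖ < 1) {i j : ℕ} (hij : i ≤ j)
    (h : eval ((g : S0 ℤ_[p]) ^ i) x = eval ((g : S0 ℤ_[p]) ^ j) x) :
    eval ((g : S0 ℤ_[p]) ^ (j - i)) x = x := by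
  refine (eval_injOn (g ^ i) hx (norm_eval_lt_one _ hx) ?_).symm
  rw [Units.val_pow_eq_pow_val, ← eval_mul _ _ hx, ← pow_add, h, Nat.add_sub_cancel' hij]

/-- Level `0` has only `p - 1` points, so two of the first `p` powers of `g` agree at `ψ 1`. If `k`
were `0`, `p` would divide the difference of their exponents, which is positive and less than `p`.
-/
theorem one_le_of_fixed_iff_le {f : S0 ℤ_[p]} {ψ : ℕ → ℂ_[p]} (hf : IsHeightOne f)
    (hψ : IsTower f ψ) {g : (S0 ℤ_[p])ˣ} (hfg : Commute f (g : S0 ℤ_[p])) (hg : (g : S0 ℤ_[p]) ≠ 1)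
    (hnorm : ∀ m : ℕ, ‖1 - (g : S0 ℤ_[p]).deriv0 ^ m‖ =
      ‖1 - (g : S0 ℤ_[p]).deriv0‖ * ‖(m : ℤ_[p])‖)
    {k : ℕ} (hfix : ∀ i, eval (g : S0 ℤ_[p]) (ψ i) = ψ i ↔ i ≤ k) : 1 ≤ k := by
  have hp := (Fact.out : p.Prime).one_lt
  by_contra hk
  have hk0 : k = 0 := by omega
  have hmaps : ∀ i ∈ Finset.range p, eval ((g : S0 ℤ_[p]) ^ i) (ψ 1) ∈
      (hf.finite_level 0).toFinset := by
    intro i _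
    rw [Set.Finite.mem_toFinset, ← Units.val_pow_eq_pow_val]
    refine eval_mem_level ?_ (hψ.mem_level 0)
    rw [Units.val_pow_eq_pow_val]; exact hfg.pow_right i
  have hcard : (hf.finite_level 0).toFinset.card < (Finset.range p).card := by
    rw [← Set.ncard_eq_toFinset_card _ (hf.finite_level 0), hf.ncard_level, Finset.card_range]
    simp; omega
  obtain ⟨i, hi, j, hj, hij, h⟩ := Finset.exists_ne_map_eq_of_card_lt_of_maps_to hcard hmaps
  wlog hlt : i < j generalizing i j
  · exact this j hj i hi hij.symm h.symm (by omega)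
  have h1 := pow_dvd_of_fixed hf hψ hfg hg hnorm hfix
    (eval_pow_sub_eq_of_eq g (hψ.norm_lt_one 1) hlt.le h)
  rw [hk0, Nat.sub_zero, pow_one] at h1
  have h2 := Nat.le_of_dvd (by omega) h1
  rw [Finset.mem_range] at hj
  omega

/-! ### The Galois action on `ℂ_[p]` -/

theorem smul_coe (σ : GQp p) (y : PadicAlgCl p) : σ • (y : ℂ_[p]) = ((σ y : PadicAlgCl p) : ℂ_[p]) :=
  (UniformSpace.Completion.coe_smul σ y).symm

/-- The extension of an automorphism of `PadicAlgCl p` to the completion `ℂ_[p]`. -/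
def galHom (σ : GQp p) : ℂ_[p] →ₐ[ℚ_[p]] ℂ_[p] where
  toFun x := σ • x
  map_one' := by
    have h := smul_coe σ 1
    rw [map_one] at h
    exact h
  map_zero' := smul_zero σ
  map_add' := smul_add σ
  map_mul' x y := by
    induction x, y using UniformSpace.Completion.induction_on₂ with
    | hp =>
      exact isClosed_eq ((continuous_const_smul σ).comp (continuous_fst.mul continuous_snd))
        (((continuous_const_smul σ).comp continuous_fst).mul
          ((continuous_const_smul σ).comp continuous_snd))
    | ih x y =>
      rw [← UniformSpace.Completion.coe_mul, smul_coe, smul_coe, smul_coe, map_mul,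
        UniformSpace.Completion.coe_mul]
  commutes' c := by
    have h := smul_coe σ (algebraMap ℚ_[p] (PadicAlgCl p) c)
    rw [AlgEquiv.commutes] at h
    exact h

theorem galHom_apply (σ : GQp p) (x : ℂ_[p]) : galHom σ x = σ • x := rfl

theorem norm_galois_smul (σ : GQp p) (x : ℂ_[p]) : ‖σ • x‖ = ‖x‖ := by
  induction x using UniformSpace.Completion.induction_on with
  | hp => exact isClosed_eq (continuous_const_smul σ).norm continuous_norm
  | ih y =>
    rw [smul_coe, UniformSpace.Completion.norm_coe, UniformSpace.Completion.norm_coe]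
    exact (spectralNorm_eq_of_equiv (K := ℚ_[p]) (L := PadicAlgCl p) σ y).symm

/-- Galois automorphisms act continuously and fix the coefficients. -/
theorem smul_eval (σ : GQp p) (g : S0 ℤ_[p]) {x : ℂ_[p]} (hx : ‖x‖ < 1) :
    σ • eval g x = eval g (σ • x) := by
  have hx' : ‖σ • x‖ < 1 := by rwa [norm_galois_smul]
  rw [eval_eq_evalHom g hx, eval_eq_evalHom g hx', evalHom_apply, evalHom_apply,
    ← galHom_apply, (summable_term g.series hx).map_tsum (galHom σ) (continuous_const_smul σ)]
  refine tsum_congr fun n => ?_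
  rw [map_mul, map_pow, intHom_apply, AlgHom.commutes]
  rfl

theorem smul_mem_level {f : S0 ℤ_[p]} (σ : GQp p) {n : ℕ} {z : ℂ_[p]} (hz : z ∈ level f n) :
    σ • z ∈ level f n := by
  refine ⟨by rw [norm_galois_smul]; exact hz.1, ?_, ?_⟩
  · rw [← smul_eval σ _ hz.1]
    intro h
    exact hz.2.1 ((map_eq_zero_iff (galHom σ) (galHom σ).toRingHom.injective).mp h)
  · rw [← smul_eval σ _ hz.1, hz.2.2, smul_zero]

theorem IsHeightOne.exists_coe_eq {f : S0 ℤ_[p]} (hf : IsHeightOne f) {n : ℕ} {z : ℂ_[p]}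
    (hz : z ∈ level f n) : ∃ y : PadicAlgCl p, (y : ℂ_[p]) = z := by
  obtain ⟨Q, -, -, -, h, -⟩ := hf.exists_irreducible n
  rw [h, ← Polynomial.Splits.image_rootSet (A := PadicAlgCl p) (IsAlgClosed.splits _)
    (IsScalarTower.toAlgHom ℚ_[p] (PadicAlgCl p) ℂ_[p])] at hz
  obtain ⟨y, -, hy⟩ := hz
  exact ⟨y, hy⟩

/-- All points of a level are algebraic with the same minimal polynomial. -/
theorem IsHeightOne.exists_smul_eq {f : S0 ℤ_[p]} (hf : IsHeightOne f) {n : ℕ} {z w : ℂ_[p]}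
    (hz : z ∈ level f n) (hw : w ∈ level f n) : ∃ σ : GQp p, σ • z = w := by
  obtain ⟨y, rfl⟩ := hf.exists_coe_eq hz
  obtain ⟨x, rfl⟩ := hf.exists_coe_eq hw
  obtain ⟨Q, hQ, hQm, -, h, -⟩ := hf.exists_irreducible n
  have key : ∀ v : PadicAlgCl p, (v : ℂ_[p]) ∈ level f n → Q = minpoly ℚ_[p] v := by
    intro v hv
    rw [h, Polynomial.mem_rootSet_of_ne hQ.ne_zero] at hv
    refine minpoly.eq_of_irreducible_of_monic hQ ?_ hQm
    rw [PadicComplex.coe_eq, Polynomial.aeval_algebraMap_apply] at hv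
    exact (map_eq_zero_iff _ (algebraMap (PadicAlgCl p) ℂ_[p]).injective).mp hv
  obtain ⟨σ, hσ⟩ := (isConjRoot_iff_exists_algEquiv (K := ℚ_[p]) (x := x) (y := y)).mp
    ((key x hw).symm.trans (key y hz))
  exact ⟨σ, by rw [smul_coe, hσ]⟩

/-- The set is empty or a coset of the stabilizer of `y`, which is closed because `y` generates a
finite extension. -/
theorem isClosed_smul_eq (y : PadicAlgCl p) (w : ℂ_[p]) :
    IsClosed {σ : GQp p | σ • (y : ℂ_[p]) = w} := by
  by_cases hne : ∃ τ : GQp p, τ • (y : ℂ_[p]) = w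
  · obtain ⟨τ, rfl⟩ := hne
    have hset : {σ : GQp p | σ • (y : ℂ_[p]) = τ • (y : ℂ_[p])} =
        (fun σ => τ⁻¹ * σ) ⁻¹' ((IntermediateField.adjoin ℚ_[p] {y}).fixingSubgroup : Set (GQp p)) := by
      ext σ
      rw [Set.mem_preimage, SetLike.mem_coe, IntermediateField.mem_fixingSubgroup_iff]
      refine Iff.trans ?_ (IntermediateField.forall_mem_adjoin_smul_eq_self_iff
        (F := ℚ_[p]) (S := {y}) (m := τ⁻¹ * σ)).symm
      simp only [Set.mem_singleton_iff, forall_eq, mul_smul, inv_smul_eq_iff]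
      constructor
      · intro h
        exact UniformSpace.Completion.coe_injective _
          ((smul_coe σ y).symm.trans (Eq.trans h (smul_coe τ y)))
      · intro h
        exact (smul_coe σ y).trans ((congrArg _ h).trans (smul_coe τ y).symm)
    rw [hset]
    have hfin : FiniteDimensional ℚ_[p] (IntermediateField.adjoin ℚ_[p] {y}) :=
      IntermediateField.adjoin.finiteDimensional (Algebra.IsIntegral.isIntegral y)
    exact (IntermediateField.fixingSubgroup_isClosed _).preimage (continuous_const_mul _)
  · have hset : {σ : GQp p | σ • (y : ℂ_[p]) = w} = ∅ :=
      Set.eq_empty_of_forall_notMem fun σ hσ => hne ⟨σ, hσ⟩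
    rw [hset]; exact isClosed_empty

theorem mem_galoisGroup_adjoin_iff (σ : GQp p) (s : Set ℂ_[p]) :
    σ ∈ galoisGroup (IntermediateField.adjoin ℚ_[p] s) ↔ ∀ x ∈ s, σ • x = x := by
  rw [galoisGroup, mem_fixingSubgroup_iff]
  constructor
  · exact fun h x hx => h x (IntermediateField.subset_adjoin _ _ hx)
  · intro h x hx
    induction hx using IntermediateField.adjoin_induction with
    | mem x hx => exact h x hx
    | algebraMap c => exact (galHom σ).commutes c
    | add x y _ _ hx hy => rw [smul_add, hx, hy]
    | inv x _ hx =>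
      rw [← galHom_apply, map_inv₀, galHom_apply, hx]
    | mul x y _ _ hx hy =>
      rw [← galHom_apply, map_mul, galHom_apply, galHom_apply, hx, hy]

/-! ### Orbits in the fibres of the iterates -/

theorem exists_pow_eval_eq {f : S0 ℤ_[p]} {ψ : ℕ → ℂ_[p]} (hf : IsHeightOne f)
    (hψ : IsTower f ψ) {g : (S0 ℤ_[p])ˣ} (hfg : Commute f (g : S0 ℤ_[p])) (hg : (g : S0 ℤ_[p]) ≠ 1)
    (hnorm : ∀ m : ℕ, ‖1 - (g : S0 ℤ_[p]).deriv0 ^ m‖ =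
      ‖1 - (g : S0 ℤ_[p]).deriv0‖ * ‖(m : ℤ_[p])‖)
    {k : ℕ} (hfix : ∀ i, eval (g : S0 ℤ_[p]) (ψ i) = ψ i ↔ i ≤ k + 1) {j : ℕ} {z : ℂ_[p]}
    (hz : ‖z‖ < 1) (hzk : eval (f ^ j) z = ψ (k + 1)) :
    ∃ s : ℕ, eval ((g : S0 ℤ_[p]) ^ s) (ψ (j + (k + 1))) = z := by
  classical
  have hp := (Fact.out : p.Prime).one_lt
  set A := (hf.finite_level (k + j)).toFinset with hA
  set B := (hf.finite_level k).toFinset with hB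
  set Fib : ℂ_[p] → Finset ℂ_[p] := fun y => A.filter fun x => eval (f ^ j) x = y with hFib
  have hcA : A.card = B.card * p ^ j := by
    rw [hA, hB, ← Set.ncard_eq_toFinset_card _ (hf.finite_level _),
      ← Set.ncard_eq_toFinset_card _ (hf.finite_level _), hf.ncard_level, hf.ncard_level, pow_add,
      mul_assoc]
  have hmaps : ∀ x ∈ A, eval (f ^ j) x ∈ B := by
    intro x hx
    rw [hA, Set.Finite.mem_toFinset] at hx
    rw [hB, Set.Finite.mem_toFinset]
    refine ⟨norm_eval_lt_one _ hx.1, ?_, ?_⟩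
    · rw [← eval_mul _ _ hx.1, ← pow_add]; exact hx.2.1
    · rw [← eval_mul _ _ hx.1, ← pow_add, add_right_comm]; exact hx.2.2
  have hB0 : 0 < B.card := by
    rw [hB, ← Set.ncard_eq_toFinset_card _ (hf.finite_level _), hf.ncard_level]
    exact Nat.mul_pos (by omega) (pow_pos (by omega) k)
  -- An automorphism taking `ψ (k + 1)` to `y` embeds the first fibre in the second. The fibre over
  -- `ψ (k + 1)` is thus no larger than the average, `p ^ j`.
  have hfib : ∀ y ∈ B, (Fib (ψ (k + 1))).card ≤ (Fib y).card := by
    intro y hy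
    rw [hB, Set.Finite.mem_toFinset] at hy
    obtain ⟨σ, hσ⟩ := hf.exists_smul_eq (hψ.mem_level k) hy
    refine Finset.card_le_card_of_injOn (fun x => σ • x) ?_ ((MulAction.injective σ).injOn)
    intro x hx
    rw [hFib, Finset.mem_coe, Finset.mem_filter, hA, Set.Finite.mem_toFinset] at hx
    rw [hFib, Finset.mem_coe, Finset.mem_filter, hA, Set.Finite.mem_toFinset]
    exact ⟨smul_mem_level σ hx.1, by rw [← smul_eval σ _ hx.1.1, hx.2, hσ]⟩
  have hle : (Fib (ψ (k + 1))).card ≤ p ^ j := by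
    have h1 := Finset.card_nsmul_le_sum B (fun y => (Fib y).card) _ hfib
    rw [← Finset.card_eq_sum_card_fiberwise hmaps, hcA, smul_eq_mul] at h1
    exact Nat.le_of_mul_le_mul_left h1 hB0
  set O := (Finset.range (p ^ j)).image fun s => eval ((g : S0 ℤ_[p]) ^ s) (ψ (j + (k + 1))) with hO
  -- A coincidence would make `p ^ j` divide a positive difference of exponents below `p ^ j`.
  have hOcard : O.card = p ^ j := by
    rw [hO, Finset.card_image_of_injOn, Finset.card_range]
    intro s hs t ht h
    by_contra hst
    wlog hlt : s < t generalizing s t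
    · exact this ht hs h.symm (Ne.symm hst) (by omega)
    have h1 := pow_dvd_of_fixed hf hψ hfg hg hnorm hfix
      (eval_pow_sub_eq_of_eq g (hψ.norm_lt_one _) hlt.le h)
    rw [Nat.add_sub_cancel] at h1
    have h2 := Nat.le_of_dvd (by omega) h1
    rw [Finset.coe_range, Set.mem_Iio] at ht
    omega
  have hsub : O ⊆ Fib (ψ (k + 1)) := by
    intro x hx
    rw [hO, Finset.mem_image] at hx
    obtain ⟨s, -, rfl⟩ := hx
    rw [hFib, Finset.mem_filter, hA, Set.Finite.mem_toFinset]
    constructor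
    · rw [← Units.val_pow_eq_pow_val]
      refine eval_mem_level (by rw [Units.val_pow_eq_pow_val]; exact hfg.pow_right s) ?_
      have h := hψ.mem_level (k + j)
      rwa [show k + j + 1 = j + (k + 1) by omega] at h
    · rw [eval_comm (hfg.pow_pow _ _) (hψ.norm_lt_one _), hψ.eval_pow]
      have h := (hfix (k + 1)).mpr le_rfl
      clear * - h hψ
      induction s with
      | zero => rw [pow_zero, eval_one (hψ.norm_lt_one _)]
      | succ s ih => rw [pow_succ, eval_mul _ _ (hψ.norm_lt_one _), h, ih]
  have heq : O = Fib (ψ (k + 1)) := Finset.eq_of_subset_of_card_le hsub (by rw [hOcard]; exact hle)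
  have hzF : z ∈ Fib (ψ (k + 1)) := by
    rw [hFib, Finset.mem_filter, hA, Set.Finite.mem_toFinset]
    have hl := hψ.mem_level k
    refine ⟨⟨hz, ?_, ?_⟩, hzk⟩
    · rw [pow_add, eval_mul _ _ hz, hzk]; exact hl.2.1
    · rw [add_right_comm, pow_add, eval_mul _ _ hz, hzk]; exact hl.2.2
  rw [← heq, hO, Finset.mem_image] at hzF
  obtain ⟨s, -, hs⟩ := hzF
  exact ⟨s, hs⟩

/-! ### Compactness of the group of iterates -/

/-- The image in the product is the closed set `a 0 = 0`; over `ℤ_[p]` this yields compactness. -/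
theorem S0.isClosedEmbedding_coeff (R : Type*) [CommRing R] [TopologicalSpace R] [T2Space R] :
    Topology.IsClosedEmbedding fun (g : S0 R) (n : ℕ) => PowerSeries.coeff n g.series := by
  refine ⟨⟨⟨rfl⟩, fun g h hgh => S0.ext (PowerSeries.ext fun n => congrFun hgh n)⟩, ?_⟩
  have hset : Set.range (fun (g : S0 R) (n : ℕ) => PowerSeries.coeff n g.series) =
      {a | a 0 = 0} := by
    ext a
    constructor
    · rintro ⟨g, rfl⟩
      exact (PowerSeries.coeff_zero_eq_constantCoeff_apply g.series).trans g.constantCoeff_eq_zero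
    · intro ha
      refine ⟨⟨PowerSeries.mk a, ?_⟩, ?_⟩
      · rw [← PowerSeries.coeff_zero_eq_constantCoeff_apply, PowerSeries.coeff_mk]; exact ha
      · funext n
        exact PowerSeries.coeff_mk n a
  rw [hset]
  exact isClosed_eq (continuous_apply 0) continuous_const

instance : CompactSpace (S0 ℤ_[p]) := (S0.isClosedEmbedding_coeff ℤ_[p]).compactSpace

instance : T2Space (S0 ℤ_[p]) := (S0.isClosedEmbedding_coeff ℤ_[p]).isEmbedding.t2Space

instance (u : (S0 ℤ_[p])ˣ) : CompactSpace (iterates u) :=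
  isCompact_iff_compactSpace.mp (Subgroup.isClosed_topologicalClosure _).isCompact

theorem continuous_eval_iterates (u : (S0 ℤ_[p])ˣ) {x : ℂ_[p]} (hx : ‖x‖ < 1) :
    Continuous fun e : iterates u => eval ((e : (S0 ℤ_[p])ˣ) : S0 ℤ_[p]) x :=
  (continuous_eval hx).comp (Units.continuous_val.comp continuous_subtype_val)

theorem self_mem_iterates (u : (S0 ℤ_[p])ˣ) : u ∈ iterates u :=
  Subgroup.le_topologicalClosure _ (Subgroup.mem_zpowers u)

theorem commute_of_mem_iterates {f : S0 ℤ_[p]} {u : (S0 ℤ_[p])ˣ}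
    (hfu : Commute f (u : S0 ℤ_[p])) (e : iterates u) :
    Commute f ((e : (S0 ℤ_[p])ˣ) : S0 ℤ_[p]) := by
  have hclosed : IsClosed {v : (S0 ℤ_[p])ˣ | f * (v : S0 ℤ_[p]) = (v : S0 ℤ_[p]) * f} :=
    isClosed_eq (continuous_const.mul Units.continuous_val)
      (Units.continuous_val.mul continuous_const)
  refine closure_minimal (s := (Subgroup.zpowers u : Set (S0 ℤ_[p])ˣ)) ?_ hclosed e.2
  rintro _ ⟨m, rfl⟩
  exact (hfu.units_zpow_right m).eq

/-- The stabilizer of a point of the open unit disk in the group of invertible series. -/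
def evalStabilizer (z : ℂ_[p]) (hz : ‖z‖ < 1) : Subgroup (S0 ℤ_[p])ˣ where
  carrier := {v | eval (v : S0 ℤ_[p]) z = z}
  one_mem' := eval_one hz
  mul_mem' {a b} ha hb := by
    have ha' : eval (a : S0 ℤ_[p]) z = z := ha
    have hb' : eval (b : S0 ℤ_[p]) z = z := hb
    show eval ((a * b : (S0 ℤ_[p])ˣ) : S0 ℤ_[p]) z = z
    rw [Units.val_mul, eval_mul _ _ hz, hb', ha']
  inv_mem' {a} ha := by
    have ha' : eval (a : S0 ℤ_[p]) z = z := ha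
    show eval ((a⁻¹ : (S0 ℤ_[p])ˣ) : S0 ℤ_[p]) z = z
    conv_lhs => rw [← ha']
    rw [← eval_mul _ _ hz, Units.inv_mul, eval_one hz]

theorem eval_eq_self_of_mem_iterates {u : (S0 ℤ_[p])ˣ} {z : ℂ_[p]} (hz : ‖z‖ < 1)
    (hu : eval (u : S0 ℤ_[p]) z = z) (e : iterates u) :
    eval ((e : (S0 ℤ_[p])ˣ) : S0 ℤ_[p]) z = z := by
  have hclosed : IsClosed (evalStabilizer z hz : Set (S0 ℤ_[p])ˣ) :=
    isClosed_eq ((continuous_eval hz).comp Units.continuous_val) continuous_const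
  exact Subgroup.topologicalClosure_minimal _
    ((Subgroup.zpowers_le (H := evalStabilizer z hz)).mpr hu) hclosed e.2

/-! ### Galois automorphisms and iterates -/

theorem eq_of_eval_tower_eq {f : S0 ℤ_[p]} {ψ : ℕ → ℂ_[p]} (hψ : IsTower f ψ) {g h : S0 ℤ_[p]}
    (hgh : ∀ n, eval g (ψ n) = eval h (ψ n)) : g = h := by
  by_contra hne
  have h0 : g.series - h.series ≠ 0 := fun h0 => hne (S0.ext (sub_eq_zero.mp h0))
  refine Set.infinite_of_injective_forall_mem hψ.injective (fun n => ?_) (finite_zeros h0)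
  refine ⟨hψ.norm_lt_one n, ?_⟩
  rw [map_sub, ← eval_eq_evalHom, ← eval_eq_evalHom, hgh, sub_self]

/-- At each index transitivity on the fibres supplies a power of `u`; the solution sets are closed
and decreasing in a compact group. -/
theorem exists_iterate_eval_eq_smul {f : S0 ℤ_[p]} {ψ : ℕ → ℂ_[p]} (hf : IsHeightOne f)
    (hψ : IsTower f ψ) {u : (S0 ℤ_[p])ˣ} (hfu : Commute f (u : S0 ℤ_[p]))
    (hu : (u : S0 ℤ_[p]) ≠ 1)
    (hnorm : ∀ m : ℕ, ‖1 - (u : S0 ℤ_[p]).deriv0 ^ m‖ =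
      ‖1 - (u : S0 ℤ_[p]).deriv0‖ * ‖(m : ℤ_[p])‖)
    {k : ℕ} (hfix : ∀ i, eval (u : S0 ℤ_[p]) (ψ i) = ψ i ↔ i ≤ k + 1)
    {σ : GQp p} (hσ : σ • ψ (k + 1) = ψ (k + 1)) :
    ∃ e : iterates u, ∀ n, eval ((e : (S0 ℤ_[p])ˣ) : S0 ℤ_[p]) (ψ n) = σ • ψ n := by
  set C : ℕ → Set (iterates u) := fun n =>
    {e | eval ((e : (S0 ℤ_[p])ˣ) : S0 ℤ_[p]) (ψ n) = σ • ψ n} with hC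
  have hclosed : ∀ n, IsClosed (C n) := fun n =>
    isClosed_eq (continuous_eval_iterates u (hψ.norm_lt_one n)) continuous_const
  have hanti : ∀ n, C (n + 1) ⊆ C n := by
    intro n e (he : eval _ _ = _)
    show eval _ _ = _
    rw [← hψ.eval_succ n, ← eval_comm (commute_of_mem_iterates hfu e) (hψ.norm_lt_one _), he,
      smul_eval σ f (hψ.norm_lt_one _)]
  have hne : ∀ n, (C n).Nonempty := by
    intro n
    obtain ⟨s, hs⟩ := exists_pow_eval_eq hf hψ hfu hu hnorm hfix (j := n)
      (z := σ • ψ (n + (k + 1))) (by rw [norm_galois_smul]; exact hψ.norm_lt_one _)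
      (by rw [← smul_eval σ _ (hψ.norm_lt_one _), hψ.eval_pow, hσ])
    -- Transitivity gives agreement at index `n + (k + 1)`, which descends to `n`.
    refine ⟨⟨u, self_mem_iterates u⟩ ^ s, antitone_nat_of_succ_le hanti (Nat.le_add_right n (k + 1)) ?_⟩
    show eval _ _ = _
    rw [← hs, Subgroup.coe_pow, Units.val_pow_eq_pow_val]
  obtain ⟨e, he⟩ := IsCompact.nonempty_iInter_of_sequence_nonempty_isCompact_isClosed C hanti hne
    (hclosed 0).isCompact hclosed
  exact ⟨e, fun n => Set.mem_iInter.mp he n⟩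

theorem exists_smul_eq_eval_iterate {f : S0 ℤ_[p]} {ψ : ℕ → ℂ_[p]} (hf : IsHeightOne f)
    (hψ : IsTower f ψ) {e : (S0 ℤ_[p])ˣ} (hfe : Commute f (e : S0 ℤ_[p])) :
    ∃ σ : GQp p, ∀ n, σ • ψ n = eval (e : S0 ℤ_[p]) (ψ n) := by
  -- The index is shifted because `ψ 0 = 0` lies in no level.
  set D : ℕ → Set (GQp p) := fun n => {σ | σ • ψ (n + 1) = eval (e : S0 ℤ_[p]) (ψ (n + 1))} with hD
  have hclosed : ∀ n, IsClosed (D n) := by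
    intro n
    obtain ⟨y, hy⟩ := hf.exists_coe_eq (hψ.mem_level n)
    have := isClosed_smul_eq y (eval (e : S0 ℤ_[p]) (ψ (n + 1)))
    rwa [hy] at this
  have hanti : ∀ n, D (n + 1) ⊆ D n := by
    intro n σ (hσ : _ • _ = _)
    show _ • _ = _
    rw [← hψ.eval_succ (n + 1), smul_eval σ f (hψ.norm_lt_one _), hσ,
      eval_comm hfe (hψ.norm_lt_one _)]
  have hne : ∀ n, (D n).Nonempty := fun n =>
    hf.exists_smul_eq (hψ.mem_level n) (eval_mem_level hfe (hψ.mem_level n))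
  obtain ⟨σ, hσ⟩ := IsCompact.nonempty_iInter_of_sequence_nonempty_isCompact_isClosed D hanti hne
    (hclosed 0).isCompact hclosed
  refine ⟨σ, fun n => ?_⟩
  cases n with
  | zero => rw [hψ.zero, eval_zero, smul_zero]
  | succ n => exact Set.mem_iInter.mp hσ n

/-- The sequence `0, π₁, π₂, …`. -/
def consZero (π : ℕ+ → ℂ_[p]) : ℕ → ℂ_[p]
  | 0 => 0
  | n + 1 => π n.succPNat

theorem consZero_coe (π : ℕ+ → ℂ_[p]) (i : ℕ+) : consZero π (i : ℕ) = π i := by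
  obtain ⟨n, rfl⟩ : ∃ n : ℕ, i = n.succPNat := ⟨i.natPred, (PNat.succPNat_natPred i).symm⟩
  rfl

theorem forall_consZero_iff {π : ℕ+ → ℂ_[p]} {P : ℂ_[p] → Prop} (h0 : P 0) :
    (∀ n, P (consZero π n)) ↔ ∀ i, P (π i) := by
  constructor
  · intro h i
    rw [← consZero_coe π i]; exact h i
  · intro h n
    cases n with
    | zero => exact h0
    | succ n => exact h n.succPNat

theorem IsConsistent.isTower {f : S0 ℤ_[p]} {π : ℕ+ → ℂ_[p]} (hπ : IsConsistent f π)
    (h1 : π 1 ≠ 0) : IsTower f (consZero π) where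
  norm_lt_one i := by
    cases i with
    | zero => simp [consZero]
    | succ n => exact hπ.norm_lt_one _
  zero := rfl
  one_ne_zero := h1
  eval_succ i := by
    cases i with
    | zero => exact hπ.eval_one
    | succ n => exact hπ.eval_succ n.succPNat

end Dyn

end

/-! ### The character homomorphism -/

theorem proposition2p8 (p : ℕ) [Fact p.Prime] (f : Dyn.S0 ℤ_[p]) (u : (Dyn.S0 ℤ_[p])ˣ)
    (hfu : Dyn.IsCommutingPair f u) (π : ℕ+ → ℂ_[p]) (hπ : Dyn.IsConsistent f π)
    (hπ1 : π 1 ≠ 0) :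
    -- the integer `k` exists
    ∃ k : ℕ+, IsGreatest {i : ℕ+ | Dyn.eval (u : Dyn.S0 ℤ_[p]) (π i) = π i} k ∧
      -- `u_σ`, hence `χ_f(σ)`, is well defined
      (∀ σ ∈ Dyn.galoisGroup (Dyn.fieldK π k), ∃! e : Dyn.iterates u,
        ∀ i, Dyn.eval ((e : (Dyn.S0 ℤ_[p])ˣ) : Dyn.S0 ℤ_[p]) (π i) = σ • π i) ∧
      -- `[a]_f` is well defined
      (∀ e e' : Dyn.iterates u,
        ((e : (Dyn.S0 ℤ_[p])ˣ) : Dyn.S0 ℤ_[p]).deriv0 =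
          ((e' : (Dyn.S0 ℤ_[p])ˣ) : Dyn.S0 ℤ_[p]).deriv0 → e = e') ∧
      -- `σ ↦ [χ_f(σ)]_f` is a surjective homomorphism with the stated kernel and values
      ∃ Φ : Dyn.galoisGroup (Dyn.fieldK π k) →* Dyn.iterates u,
        (∀ σ, Φ σ = Dyn.bracket u (Dyn.chi u π σ)) ∧
        Function.Surjective Φ ∧
        Φ.ker = (Dyn.galoisGroup (Dyn.fieldKInf π)).subgroupOf
          (Dyn.galoisGroup (Dyn.fieldK π k)) ∧
        ∀ (σ : Dyn.galoisGroup (Dyn.fieldK π k)) (i : ℕ+),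
          Dyn.eval ((Dyn.bracket u (Dyn.chi u π σ) : (Dyn.S0 ℤ_[p])ˣ) : Dyn.S0 ℤ_[p]) (π i) =
            (σ : Dyn.GQp p) • π i := by
  have hf : Dyn.IsHeightOne f := Dyn.isHeightOne_of_ncard_roots hfu.valuation_deriv hfu.card_roots
  have hcomm : Commute f (u : Dyn.S0 ℤ_[p]) := hfu.comm
  have hu : (u : Dyn.S0 ℤ_[p]) ≠ 1 := by
    intro h
    apply hfu.infinite_order
    rw [Units.val_eq_one.mp h]
    exact IsOfFinOrder.one
  have hψ := hπ.isTower hπ1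
  obtain ⟨k, hfix⟩ := Dyn.exists_fixed_iff_le hψ hcomm hu
  have hk := Dyn.one_le_of_fixed_iff_le hf hψ hcomm hu hfu.norm_one_sub_pow hfix
  obtain ⟨k, rfl⟩ : ∃ j, k = j + 1 := ⟨k - 1, by omega⟩
  have hfixπ : ∀ i : ℕ+, Dyn.eval (u : Dyn.S0 ℤ_[p]) (π i) = π i ↔ i ≤ k.succPNat := by
    intro i
    rw [← Dyn.consZero_coe π i, hfix, ← PNat.coe_le_coe, Nat.succPNat_coe]
  have hfixer : ∀ σ : Dyn.GQp p,
      σ ∈ Dyn.galoisGroup (Dyn.fieldK π k.succPNat) ↔ σ • π k.succPNat = π k.succPNat := by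
    intro σ
    rw [Dyn.fieldK, Dyn.mem_galoisGroup_adjoin_iff]
    simp
  have huniq : ∀ e e' : Dyn.iterates u,
      (∀ i, Dyn.eval ((e : (Dyn.S0 ℤ_[p])ˣ) : Dyn.S0 ℤ_[p]) (π i) =
        Dyn.eval ((e' : (Dyn.S0 ℤ_[p])ˣ) : Dyn.S0 ℤ_[p]) (π i)) → e = e' := by
    intro e e' h
    refine Subtype.ext (Units.ext (Dyn.eq_of_eval_tower_eq hψ ?_))
    rw [Dyn.forall_consZero_iff (P := fun x => Dyn.eval ((e : (Dyn.S0 ℤ_[p])ˣ) : Dyn.S0 ℤ_[p]) x =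
      Dyn.eval ((e' : (Dyn.S0 ℤ_[p])ˣ) : Dyn.S0 ℤ_[p]) x) (by rw [Dyn.eval_zero, Dyn.eval_zero])]
    exact h
  have hexists : ∀ σ ∈ Dyn.galoisGroup (Dyn.fieldK π k.succPNat), ∃ e : Dyn.iterates u,
      ∀ i, Dyn.eval ((e : (Dyn.S0 ℤ_[p])ˣ) : Dyn.S0 ℤ_[p]) (π i) = σ • π i := by
    intro σ hσ
    obtain ⟨e, he⟩ := Dyn.exists_iterate_eval_eq_smul hf hψ hcomm hu hfu.norm_one_sub_pow hfix
      (σ := σ) ((hfixer σ).mp hσ)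
    refine ⟨e, fun i => ?_⟩
    rw [← Dyn.consZero_coe π i]; exact he i
  have hderiv : ∀ e e' : Dyn.iterates u,
      ((e : (Dyn.S0 ℤ_[p])ˣ) : Dyn.S0 ℤ_[p]).deriv0 =
        ((e' : (Dyn.S0 ℤ_[p])ˣ) : Dyn.S0 ℤ_[p]).deriv0 → e = e' := fun e e' h =>
    Subtype.ext (Units.ext (Dyn.S0.eq_of_deriv0_eq (Dyn.deriv0_ne_zero_of_norm hf.norm_deriv0)
      (Dyn.not_isUnit_deriv0 hf.norm_deriv0) (Dyn.commute_of_mem_iterates hcomm e)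
      (Dyn.commute_of_mem_iterates hcomm e') h))
  -- The choice in `bracket` is meaningful for every `σ`: `galoisIterate u π σ` itself has linear
  -- coefficient `chi u π σ`.
  have hbracket : ∀ σ, Dyn.bracket u (Dyn.chi u π σ) = Dyn.galoisIterate u π σ := fun σ =>
    hderiv _ _ (Classical.epsilon_spec (p := fun e : Dyn.iterates u =>
      ((e : (Dyn.S0 ℤ_[p])ˣ) : Dyn.S0 ℤ_[p]).deriv0 = Dyn.chi u π σ) ⟨_, rfl⟩)
  have hspec : ∀ (σ : Dyn.galoisGroup (Dyn.fieldK π k.succPNat)) (i : ℕ+),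
      Dyn.eval ((Dyn.galoisIterate u π σ : (Dyn.S0 ℤ_[p])ˣ) : Dyn.S0 ℤ_[p]) (π i) =
        (σ : Dyn.GQp p) • π i := fun σ =>
    Classical.epsilon_spec (hexists σ σ.2)
  have hlt : ∀ (σ : Dyn.GQp p) i, ‖σ • π i‖ < 1 := fun σ i => by
    rw [Dyn.norm_galois_smul]; exact hπ.norm_lt_one i
  let Φ : Dyn.galoisGroup (Dyn.fieldK π k.succPNat) →* Dyn.iterates u :=
    { toFun := fun σ => Dyn.galoisIterate u π σ
      map_one' := huniq _ _ fun i => by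
        rw [hspec, OneMemClass.coe_one, OneMemClass.coe_one, one_smul, Units.val_one,
          Dyn.eval_one (hπ.norm_lt_one i)]
      map_mul' := fun σ τ => by
        -- Composition comes out reversed: `στ(π_i) = σ(u_τ(π_i)) = u_τ(σ(π_i)) = u_τ(u_σ(π_i))`.
        -- The two orders agree because they have the same linear coefficient.
        have hc : Dyn.galoisIterate u π σ * Dyn.galoisIterate u π τ =
            Dyn.galoisIterate u π τ * Dyn.galoisIterate u π σ := by
          apply hderiv
          simp only [Subgroup.coe_mul, Units.val_mul, Dyn.S0.deriv0_mul, mul_comm]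
        refine (huniq _ _ fun i => ?_).trans hc.symm
        rw [hspec, Subgroup.coe_mul, Subgroup.coe_mul, Units.val_mul,
          Dyn.eval_mul _ _ (hπ.norm_lt_one i), hspec, mul_smul, ← hspec τ,
          Dyn.smul_eval _ _ (hπ.norm_lt_one i)] }
  refine ⟨k.succPNat, ⟨(hfixπ _).mpr le_rfl, fun i hi => (hfixπ i).mp hi⟩, ?_, hderiv,
    Φ, fun σ => (hbracket σ).symm, ?_, ?_, ?_⟩
  · intro σ hσ
    obtain ⟨e, he⟩ := hexists σ hσ
    exact ⟨e, he, fun e' he' => huniq _ _ fun i => (he' i).trans (he i).symm⟩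
  · intro e
    obtain ⟨σ, hσ⟩ := Dyn.exists_smul_eq_eval_iterate hf hψ (Dyn.commute_of_mem_iterates hcomm e)
    have hσπ : ∀ i, σ • π i = Dyn.eval ((e : (Dyn.S0 ℤ_[p])ˣ) : Dyn.S0 ℤ_[p]) (π i) := fun i => by
      rw [← Dyn.consZero_coe π i]; exact hσ i
    have hmem : σ ∈ Dyn.galoisGroup (Dyn.fieldK π k.succPNat) := by
      rw [hfixer, hσπ]
      exact Dyn.eval_eq_self_of_mem_iterates (hπ.norm_lt_one _) ((hfixπ _).mpr le_rfl) e
    exact ⟨⟨σ, hmem⟩, huniq _ _ fun i => (hspec ⟨σ, hmem⟩ i).trans (hσπ i)⟩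
  · ext σ
    rw [MonoidHom.mem_ker, Subgroup.mem_subgroupOf, Dyn.fieldKInf, Dyn.mem_galoisGroup_adjoin_iff,
      Set.forall_mem_range]
    constructor
    · intro h i
      rw [← hspec σ i, show Dyn.galoisIterate u π σ = 1 from h, OneMemClass.coe_one, Units.val_one,
        Dyn.eval_one (hπ.norm_lt_one i)]
    · intro h
      refine huniq _ _ fun i => (hspec σ i).trans ?_
      rw [h i, OneMemClass.coe_one, Units.val_one, Dyn.eval_one (hπ.norm_lt_one i)]
  · intro σ i
    rw [hbracket, hspec]
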